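/- Model. Let $n\ge 4$, $k\ge 2$, $d$ be integers, $\boldsymbol\mu_1,\dots,\boldsymbol\mu_k\in\mathbb R^d$ cluster centers, and $\sigma^*:[n]\to[k]$ labels with balanced clusters, $|\{i:\sigma^*(i)=a\}|=n/k$ for every $a\in[k]$. Let $\mathbf g_1,\dots,\mathbf g_n$ be independent random vectors in $\mathbb R^d$ with $\mathbb E\,\mathbf g_i=0$ and sub-Gaussian norm $\|\mathbf g_i\|_{\psi_2}\le\tau$, where $\tau>0$, $\|X\|_{\psi_2}=\inf\{t>0:\mathbb E\exp(X^2/t^2)\le 2\}$ for a random variable and $\|\mathbf x\|_{\psi_2}=\sup_{\|\mathbf u\|_2=1}\|\langle\mathbf x,\mathbf u\rangle\|_{\psi_2}$ for a random vector. We observe $\mathbf h_i=\boldsymbol\mu_{\sigma^*(i)}+\mathbf g_i$, $i\in[n]$. Put $\Delta=\min_{a\ne b}\|\boldsymbol\mu_a-\boldsymbol\mu_b\|_2$ and $s=\Delta/\tau$. Let $A_{ij}=\|\mathbf h_i-\mathbf h_j\|_2^2$, let $Y^*_{ij}=1$ if $\sigma^*(i)=\sigma^*(j)$ and $Y^*_{ij}=0$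 otherwise, let $\|M\|_1=\sum_{i,j}|M_{ij}|$, and consider the semidefinite program (SDP) $$\min_{Y\in\mathbb R^{n\times n}}\ \langle Y,A\rangle\quad\text{subject to}\quad Y\mathbf 1=\tfrac nk\mathbf 1,\quad Y\succeq 0,\quad \operatorname{diag}(Y)=\mathbf 1,\quad Y\ge 0\ \text{entrywise}.$$ (1) There exist universal constants $C_s,C_m,C_e>0$ such that, if $$s^2\ \ge\ C_s\Big(\sqrt{\tfrac{kd}{n}\log n}+\tfrac{kd}{n}+k\Big),$$ then with probability at least $1-2/n$ the SDP has an optimal solution and every optimal solution $\hat Y$ of it satisfies $$\frac{\|\hat Y-Y^*\|_1}{\|Y^*\|_1}\ \le\ C_m\exp\!\Big(-\frac{s^2}{C_e}\Big).$$ (2) (Exact recovery.) For every constant $A_0>0$ there is a constant $C>0$, depending only on $A_0$, such that, if $d\le A_0 n$ and $s^2\ge C(k+\log n)$, then with probability at least $1-2/n$ the SDP has an optimal solution and every optimal solution $\hat Y$ of it satisfies $\|\hat Y-Y^*\|_1<\tfrac14$; in particular, rounding each entry of $\hat Y$ to the nearest integer gives exactly $Y^*$. -/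

import Mathlib

open MeasureTheory ProbabilityTheory
open scoped ENNReal

universe u

noncomputable section

namespace SGMM

/-- The sub-Gaussian norm `inf {t > 0 : E exp (X² / t²) ≤ 2}` of a real random variable, with
value `∞` when there is no such `t`. -/
def psi2Norm {Ω : Type*} [MeasurableSpace Ω] (P : Measure Ω) (X : Ω → ℝ) : ℝ≥0∞ :=
  sInf {r : ℝ≥0∞ | ∃ t : ℝ, 0 < t ∧ r = ENNReal.ofReal t ∧
    ∫⁻ ω, ENNReal.ofReal (Real.exp (X ω ^ 2 / t ^ 2)) ∂P ≤ 2}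

/-- The sub-Gaussian norm of a random vector: the supremum of the sub-Gaussian norms of its
one-dimensional marginals along unit vectors. -/
def psi2NormVec {Ω : Type*} [MeasurableSpace Ω] (P : Measure Ω) {d : ℕ}
    (x : Ω → EuclideanSpace ℝ (Fin d)) : ℝ≥0∞ :=
  ⨆ u ∈ Metric.sphere (0 : EuclideanSpace ℝ (Fin d)) 1, psi2Norm P (fun ω => inner ℝ (x ω) u)

/-- The balanced sub-Gaussian mixture model: `n` points, `k` clusters with labels `σ`, and noise
vectors `g i` that are independent, centered and of sub-Gaussian norm at most `τ`. The cluster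
centers enter only through `point` below. -/
structure IsModel {Ω : Type*} [MeasurableSpace Ω] (P : Measure Ω) {n k d : ℕ}
    (σ : Fin n → Fin k) (g : Fin n → Ω → EuclideanSpace ℝ (Fin d)) (τ : ℝ) : Prop where
  measurable : ∀ i, Measurable (g i)
  indep : iIndepFun g P
  centered : ∀ i, ∫ ω, g i ω ∂P = 0
  tau_pos : 0 < τ
  subgaussian : ∀ i, psi2NormVec P (g i) ≤ ENNReal.ofReal τ
  balanced : ∀ a : Fin k,
    ((Finset.univ.filter (fun i : Fin n => σ i = a)).card : ℝ) = (n : ℝ) / (k : ℝ)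

/-- The observed points: cluster center plus noise. -/
def point {Ω : Type*} {n k d : ℕ} (μ : Fin k → EuclideanSpace ℝ (Fin d)) (σ : Fin n → Fin k)
    (g : Fin n → Ω → EuclideanSpace ℝ (Fin d)) (ω : Ω) (i : Fin n) : EuclideanSpace ℝ (Fin d) :=
  μ (σ i) + g i ω

/-- The minimum separation of the centers (a minimum over a nonempty finite set if `2 ≤ k`). -/
def minSep {k d : ℕ} (μ : Fin k → EuclideanSpace ℝ (Fin d)) : ℝ :=
  ⨅ p : {p : Fin k × Fin k // p.1 ≠ p.2}, ‖μ p.1.1 - μ p.1.2‖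

/-- The signal-to-noise ratio. -/
def snr {k d : ℕ} (μ : Fin k → EuclideanSpace ℝ (Fin d)) (τ : ℝ) : ℝ :=
  minSep μ / τ

/-- The matrix of pairwise squared distances. -/
def sqDistMatrix {n d : ℕ} (h : Fin n → EuclideanSpace ℝ (Fin d)) :
    Matrix (Fin n) (Fin n) ℝ :=
  Matrix.of fun i j => ‖h i - h j‖ ^ 2

/-- Feasibility for the semidefinite program with `k` clusters. -/
structure IsFeasible {n : ℕ} (k : ℕ) (Y : Matrix (Fin n) (Fin n) ℝ) : Prop where
  rowSum : Matrix.mulVec Y (fun _ => 1) = fun _ => (n : ℝ) / (k : ℝ)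
  psd : Y.PosSemidef
  diag : ∀ i, Y i i = 1
  nonneg : ∀ i j, 0 ≤ Y i j

/-- `Y` is an optimal solution of the semidefinite program: it minimizes the trace inner product
with the matrix of squared distances over the feasible set. -/
def IsSDPSolution {n d : ℕ} (k : ℕ) (h : Fin n → EuclideanSpace ℝ (Fin d))
    (Y : Matrix (Fin n) (Fin n) ℝ) : Prop :=
  IsFeasible k Y ∧ ∀ Z : Matrix (Fin n) (Fin n) ℝ, IsFeasible k Z →
    (Y.transpose * sqDistMatrix h).trace ≤ (Z.transpose * sqDistMatrix h).trace

/-- The true cluster matrix. -/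
def trueClusterMatrix {n k : ℕ} (σ : Fin n → Fin k) : Matrix (Fin n) (Fin n) ℝ :=
  Matrix.of fun i j => if σ i = σ j then 1 else 0

/-- The entrywise `ℓ₁` norm. -/
def l1Norm {n : ℕ} (M : Matrix (Fin n) (Fin n) ℝ) : ℝ :=
  ∑ i, ∑ j, |M i j|

/-- Elementwise rounding to the nearest integer. -/
def roundMatrix {n : ℕ} (M : Matrix (Fin n) (Fin n) ℝ) : Matrix (Fin n) (Fin n) ℝ :=
  Matrix.of fun i j => ((round (M i j) : ℤ) : ℝ)

end SGMM

end

/-! The argument separates a deterministic inequality from three probabilistic events. Put `m = n/k`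
and let `crossMass` be the mass of `Y` between different clusters. Since row sums are fixed, the
`ℓ₁` error is exactly twice `crossMass`, so it suffices to bound the latter.

Write each point as an empirical cluster center plus noise centered within its cluster. Fixed row
sums make the squared noise norms cancel when the objectives at `Y` and at the true matrix are
compared. There remain a separation term with its linear noise, supported on cross-cluster pairs,
and a quadratic noise term. If `Y = BᵀB`, centering can be moved from the noise to the rows of `B`,
whose centered part has total square norm `crossMass / m`. Hence the quadratic term is at most `K *
crossMass / m`, with `K` the squared operator norm of the noise, and is absorbed by the separation
(`sum_mul_inner_centered_le`). Linear noise is harmless except for pairs `(i, b)` with an atypically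
large projection, whose cost is `bad i b`; this gives `crossMass_le`.

Three events control the noise. `exists_event_operator_norm` averages an exponential over a ball.
`exists_event_cross_terms` applies a Chernoff bound conditionally on one noise vector.
`exists_event_sum_exp` applies Chebyshev's inequality to sums of Gaussian-type weights. The factor
`exp (-s²/4096)` arises because a bad projection must be of order `s`, so it can be charged to such
a weight (`linear_term_le`). Exact recovery follows once `s²` beats the logarithm of the total mass
`n²/k`. -/

namespace SGMM

/-! ### Feasible matrices and the deterministic error bound. -/

section Deterministic

variable {n k : ℕ} {m : ℝ} {σ : Fin n → Fin k} {Y : Matrix (Fin n) (Fin n) ℝ}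

lemma IsFeasible.symm (hY : IsFeasible k Y) (i j : Fin n) : Y i j = Y j i := by
  have := hY.psd.1.apply j i
  simpa using this

lemma IsFeasible.sum_row (hY : IsFeasible k Y) (i : Fin n) : ∑ j, Y i j = (n : ℝ) / k := by
  have := congrFun hY.rowSum i
  simpa [Matrix.mulVec, dotProduct] using this

/-- Positive semidefiniteness tested on the difference of two basis vectors, with unit diagonal. -/
lemma IsFeasible.le_one (hY : IsFeasible k Y) (i j : Fin n) : Y i j ≤ 1 := by
  classical
  have h := hY.psd.dotProduct_mulVec_nonneg (Pi.single i 1 - Pi.single j 1)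
  simp [Matrix.mulVec_sub, sub_dotProduct, dotProduct_sub, hY.diag, hY.symm j i] at h
  linarith

lemma trueClusterMatrix_isFeasible
    (hσ : ∀ a, ((Finset.univ.filter fun i => σ i = a).card : ℝ) = (n : ℝ) / k) :
    IsFeasible k (trueClusterMatrix σ) where
  rowSum := by
    ext i
    have h := hσ (σ i)
    simp only [Matrix.mulVec, dotProduct, trueClusterMatrix, Matrix.of_apply, mul_one,
      Finset.sum_boole]
    rw [← h]
    congr 2
    ext j
    simp [eq_comm]
  psd := by
    have : trueClusterMatrix σ =
        (Matrix.of fun (a : Fin k) i => if σ i = a then (1 : ℝ) else 0).conjTranspose *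
          Matrix.of fun (a : Fin k) i => if σ i = a then (1 : ℝ) else 0 := by
      ext i j
      simp [trueClusterMatrix, Matrix.mul_apply, eq_comm]
    rw [this]
    exact Matrix.posSemidef_conjTranspose_mul_self _
  diag i := by simp [trueClusterMatrix]
  nonneg i j := by
    simp only [trueClusterMatrix, Matrix.of_apply]
    split_ifs <;> norm_num

lemma trace_transpose_mul_sqDistMatrix {d : ℕ} (h : Fin n → EuclideanSpace ℝ (Fin d))
    (Y : Matrix (Fin n) (Fin n) ℝ) :
    (Y.transpose * sqDistMatrix h).trace = ∑ i, ∑ j, Y i j * ‖h i - h j‖ ^ 2 := by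
  simp only [Matrix.trace, Matrix.diag, Matrix.mul_apply, Matrix.transpose_apply, sqDistMatrix,
    Matrix.of_apply]
  exact Finset.sum_comm

/-- The semidefinite program attains its minimum as soon as it is feasible. -/
lemma exists_isSDPSolution {d : ℕ} (h : Fin n → EuclideanSpace ℝ (Fin d))
    (hne : ∃ Z : Matrix (Fin n) (Fin n) ℝ, IsFeasible k Z) : ∃ Y, IsSDPSolution k h Y := by
  have hset : {Z : Matrix (Fin n) (Fin n) ℝ | IsFeasible k Z} =
      {Z | Matrix.mulVec Z (fun _ => 1) = fun _ => (n : ℝ) / (k : ℝ)} ∩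
        ({Z | Z.conjTranspose = Z} ∩
          ⋂ x : Fin n → ℝ, {Z | 0 ≤ star x ⬝ᵥ Matrix.mulVec Z x}) ∩
        (⋂ i, {Z | Z i i = 1}) ∩ ⋂ i, ⋂ j, {Z | 0 ≤ Z i j} := by
    ext Z
    simp only [Set.mem_ofPred_eq, Set.mem_inter_iff, Set.mem_iInter]
    constructor
    · intro hZ
      exact ⟨⟨⟨hZ.rowSum, hZ.psd.1, fun x => hZ.psd.dotProduct_mulVec_nonneg x⟩, hZ.diag⟩,
        hZ.nonneg⟩
    · rintro ⟨⟨⟨h1, h2, h3⟩, h4⟩, h5⟩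
      exact ⟨h1, Matrix.PosSemidef.of_dotProduct_mulVec_nonneg h2 h3, h4, h5⟩
  have hclosed : IsClosed {Z : Matrix (Fin n) (Fin n) ℝ | IsFeasible k Z} := by
    rw [hset]
    refine (((isClosed_eq (by fun_prop) continuous_const).inter
      ((isClosed_eq (by fun_prop) continuous_id).inter
        (isClosed_iInter fun x => isClosed_le continuous_const (by fun_prop)))).inter
      (isClosed_iInter fun i => isClosed_eq (by fun_prop) continuous_const)).inter
      (isClosed_iInter fun i => isClosed_iInter fun j =>
        isClosed_le continuous_const (by fun_prop))
  have hcompact : IsCompact {Z : Matrix (Fin n) (Fin n) ℝ | IsFeasible k Z} := by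
    have hbox : IsCompact (Set.univ.pi fun _ : Fin n => Set.univ.pi fun _ : Fin n =>
        Set.Icc (0 : ℝ) 1) :=
      isCompact_univ_pi fun _ => isCompact_univ_pi fun _ => isCompact_Icc
    refine IsCompact.of_isClosed_subset (hbox : IsCompact (X := Matrix (Fin n) (Fin n) ℝ) _)
      hclosed ?_
    intro Z hZ i _ j _
    exact ⟨hZ.nonneg i j, hZ.le_one i j⟩
  obtain ⟨Y, hY, hmin⟩ := hcompact.exists_isMinOn hne
    (f := fun Z : Matrix (Fin n) (Fin n) ℝ => (Z.transpose * sqDistMatrix h).trace)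
    (by fun_prop)
  exact ⟨Y, hY, fun Z hZ => hmin hZ⟩

/-- The mass that `Y` puts on pairs of points from different clusters. -/
noncomputable def crossMass (σ : Fin n → Fin k) (Y : Matrix (Fin n) (Fin n) ℝ) : ℝ :=
  ∑ i, ∑ j, if σ i = σ j then 0 else Y i j

lemma IsFeasible.crossMass_nonneg (hY : IsFeasible k Y) : 0 ≤ crossMass σ Y := by
  refine Finset.sum_nonneg fun i _ => Finset.sum_nonneg fun j _ => ?_
  split_ifs
  exacts [le_rfl, hY.nonneg i j]

/-- Both matrices have the same row sums and entries in `[0, 1]`, so in each row the mass missing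
inside the cluster equals the mass found outside it. -/
lemma IsFeasible.l1Norm_sub (hY : IsFeasible k Y)
    (hσ : ∀ a, ((Finset.univ.filter fun i => σ i = a).card : ℝ) = (n : ℝ) / k) :
    l1Norm (Y - trueClusterMatrix σ) = 2 * crossMass σ Y := by
  unfold l1Norm crossMass
  rw [Finset.mul_sum]
  refine Finset.sum_congr rfl fun i _ => ?_
  have h1 := hY.sum_row i
  have h2 := (trueClusterMatrix_isFeasible hσ).sum_row i
  have h3 : ∀ j, |(Y - trueClusterMatrix σ) i j| =
      2 * (if σ i = σ j then 0 else Y i j) - Y i j + trueClusterMatrix σ i j := by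
    intro j
    simp only [trueClusterMatrix, Matrix.sub_apply, Matrix.of_apply]
    split_ifs
    · rw [abs_of_nonpos (by linarith [hY.le_one i j])]; ring
    · rw [sub_zero, abs_of_nonneg (hY.nonneg i j)]; ring
  rw [Finset.sum_congr rfl fun j _ => h3 j, Finset.sum_add_distrib, Finset.sum_sub_distrib, h1, h2,
    Finset.mul_sum]
  ring

lemma l1Norm_trueClusterMatrix
    (hσ : ∀ a, ((Finset.univ.filter fun i => σ i = a).card : ℝ) = (n : ℝ) / k) :
    l1Norm (trueClusterMatrix σ) = n * ((n : ℝ) / k) := by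
  have hf := trueClusterMatrix_isFeasible hσ
  unfold l1Norm
  simp_rw [fun i j => abs_of_nonneg (hf.nonneg i j), hf.sum_row]
  simp

/-! ### Decomposition of the objective and control of the noise. -/

variable {E : Type*} [NormedAddCommGroup E] [InnerProductSpace ℝ E]

/-- The average of `g` over the cluster `a`, for clusters of size `m`. -/
noncomputable def clusterMean (m : ℝ) (σ : Fin n → Fin k) (g : Fin n → E) (a : Fin k) : E :=
  m⁻¹ • ∑ j with σ j = a, g j

lemma sum_centered_eq_zero (hm : m ≠ 0)
    (hσ : ∀ a, ((Finset.univ.filter fun i => σ i = a).card : ℝ) = m) (g : Fin n → E) (a : Fin k) :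
    ∑ j with σ j = a, (g j - clusterMean m σ g (σ j)) = 0 := by
  have h : ∀ j ∈ Finset.univ.filter (fun j => σ j = a),
      g j - clusterMean m σ g (σ j) = g j - clusterMean m σ g a := by
    intro j hj
    rw [(Finset.mem_filter.1 hj).2]
  rw [Finset.sum_congr rfl h, Finset.sum_sub_distrib, Finset.sum_const, ← Nat.cast_smul_eq_nsmul ℝ,
    hσ, clusterMean, smul_smul, mul_inv_cancel₀ hm, one_smul, sub_self]

/-- Constant row sums turn the squared norms of `q` into a term independent of `Y`; symmetry merges
the two mixed terms into one with coefficient 4. -/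
lemma sum_mul_sqDist (hsymm : ∀ i j, Y i j = Y j i) (hrow : ∀ i, ∑ j, Y i j = m)
    (p q : Fin n → E) :
    ∑ i, ∑ j, Y i j * ‖(p i + q i) - (p j + q j)‖ ^ 2 =
      ∑ i, ∑ j, Y i j * (‖p j - p i‖ ^ 2 - 4 * inner ℝ (q i) (p j - p i))
        + 2 * m * ∑ i, ‖q i‖ ^ 2 - 2 * ∑ i, ∑ j, Y i j * inner ℝ (q i) (q j) := by
  have hterm : ∀ i j, Y i j * ‖(p i + q i) - (p j + q j)‖ ^ 2 =
      Y i j * (‖p j - p i‖ ^ 2 - 2 * inner ℝ (q i) (p j - p i)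
        - 2 * inner ℝ (q j) (p i - p j))
        + Y i j * ‖q i‖ ^ 2 + Y i j * ‖q j‖ ^ 2 - 2 * (Y i j * inner ℝ (q i) (q j)) := by
    intro i j
    have : (p i + q i) - (p j + q j) = (p i - p j) + (q i - q j) := by abel
    rw [this, norm_add_sq_real, norm_sub_sq_real (q i), norm_sub_rev (p i)]
    simp only [inner_sub_left, inner_sub_right]
    rw [real_inner_comm (p i) (q i), real_inner_comm (p i) (q j), real_inner_comm (p j) (q i),
      real_inner_comm (p j) (q j)]
    ring
  have hswap : ∑ i, ∑ j, Y i j * (2 * inner ℝ (q j) (p i - p j)) =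
      ∑ i, ∑ j, Y i j * (2 * inner ℝ (q i) (p j - p i)) := by
    rw [Finset.sum_comm]
    exact Finset.sum_congr rfl fun i _ => Finset.sum_congr rfl fun j _ => by rw [hsymm]
  have h1 : ∑ i, ∑ j, Y i j * ‖q i‖ ^ 2 = m * ∑ i, ‖q i‖ ^ 2 := by
    simp_rw [← Finset.sum_mul, hrow, Finset.mul_sum]
  have h2 : ∑ i, ∑ j, Y i j * ‖q j‖ ^ 2 = m * ∑ i, ‖q i‖ ^ 2 := by
    rw [← h1, Finset.sum_comm]
    exact Finset.sum_congr rfl fun i _ => Finset.sum_congr rfl fun j _ => by rw [hsymm]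
  have hsplit : ∑ i, ∑ j, Y i j * (‖p j - p i‖ ^ 2 - 4 * inner ℝ (q i) (p j - p i)) =
      ∑ i, ∑ j, Y i j * (‖p j - p i‖ ^ 2 - 2 * inner ℝ (q i) (p j - p i)
        - 2 * inner ℝ (q j) (p i - p j)) := by
    simp only [mul_sub, Finset.sum_sub_distrib] at hswap ⊢
    rw [hswap]
    simp only [← Finset.sum_sub_distrib]
    exact Finset.sum_congr rfl fun i _ => Finset.sum_congr rfl fun j _ => by ring
  rw [hsplit, Finset.sum_congr rfl fun i _ => Finset.sum_congr rfl fun j _ => hterm i j]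
  rw [Finset.sum_congr rfl fun i _ => show _ = ∑ j, Y i j * (‖p j - p i‖ ^ 2
    - 2 * inner ℝ (q i) (p j - p i) - 2 * inner ℝ (q j) (p i - p j)) + ∑ j, Y i j * ‖q i‖ ^ 2
      + ∑ j, Y i j * ‖q j‖ ^ 2 - 2 * ∑ j, Y i j * inner ℝ (q i) (q j) by
    rw [Finset.sum_sub_distrib, Finset.sum_add_distrib, Finset.sum_add_distrib, Finset.mul_sum]]
  rw [Finset.sum_sub_distrib, Finset.sum_add_distrib, Finset.sum_add_distrib, h1, h2,
    ← Finset.mul_sum]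
  ring

/-- For feasible `Y`, the excess of the SDP objective over its value at the true clustering. -/
lemma objective_sub (hm : m ≠ 0) (hmk : (n : ℝ) / k = m)
    (hσ : ∀ a, ((Finset.univ.filter fun i => σ i = a).card : ℝ) = m) (hY : IsFeasible k Y)
    (ν : Fin k → E) (g : Fin n → E) (q : Fin n → E)
    (hq : ∀ i, q i = g i - clusterMean m σ g (σ i)) :
    ∑ i, ∑ j, Y i j * ‖(ν (σ i) + q i) - (ν (σ j) + q j)‖ ^ 2
      - ∑ i, ∑ j, trueClusterMatrix σ i j * ‖(ν (σ i) + q i) - (ν (σ j) + q j)‖ ^ 2 =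
    ∑ i, ∑ j, Y i j * (‖ν (σ j) - ν (σ i)‖ ^ 2 - 4 * inner ℝ (q i) (ν (σ j) - ν (σ i)))
      - 2 * ∑ i, ∑ j, Y i j * inner ℝ (q i) (q j) := by
  subst hmk
  have hf := trueClusterMatrix_isFeasible hσ
  rw [sum_mul_sqDist (Y := Y) hY.symm hY.sum_row (fun i => ν (σ i)) q,
    sum_mul_sqDist hf.symm hf.sum_row (fun i => ν (σ i)) q]
  have h1 : ∑ i, ∑ j, trueClusterMatrix σ i j *
      (‖ν (σ j) - ν (σ i)‖ ^ 2 - 4 * inner ℝ (q i) (ν (σ j) - ν (σ i))) = 0 := by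
    refine Finset.sum_eq_zero fun i _ => Finset.sum_eq_zero fun j _ => ?_
    simp only [trueClusterMatrix, Matrix.of_apply]
    split_ifs with h
    · simp [h]
    · simp
  have h2 : ∑ i, ∑ j, trueClusterMatrix σ i j * inner ℝ (q i) (q j) = 0 := by
    refine Finset.sum_eq_zero fun i _ => ?_
    have h0 := sum_centered_eq_zero hm hσ g (σ i)
    simp only [← hq] at h0
    have : ∑ j, trueClusterMatrix σ i j * inner ℝ (q i) (q j) =
        inner ℝ (q i) (∑ j with σ j = σ i, q j) := by
      rw [inner_sum, Finset.sum_filter]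
      refine Finset.sum_congr rfl fun j _ => ?_
      simp [trueClusterMatrix, eq_comm]
    rw [this, h0, inner_zero_right]
  rw [h1, h2]
  ring

/-- An operator and its adjoint have the same norm: pair the sum `w` with itself, apply
Cauchy–Schwarz and cancel `‖w‖²`. -/
lemma norm_sq_sum_smul_le {K : ℝ} (hK0 : 0 ≤ K) {g : Fin n → E}
    (hK : ∀ u : E, ∑ i, inner ℝ (g i) u ^ 2 ≤ K * ‖u‖ ^ 2) (x : Fin n → ℝ) :
    ‖∑ i, x i • g i‖ ^ 2 ≤ K * ∑ i, x i ^ 2 := by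
  set w := ∑ i, x i • g i with hw
  have h0 : 0 ≤ ∑ i, x i ^ 2 := Finset.sum_nonneg fun i _ => sq_nonneg _
  have h1 : ‖w‖ ^ 2 = ∑ i, x i * inner ℝ (g i) w := by
    rw [← real_inner_self_eq_norm_sq]
    conv_lhs => enter [2]; rw [hw]
    simp only [sum_inner, real_inner_smul_left]
  have h2 : (‖w‖ ^ 2) ^ 2 ≤ (∑ i, x i ^ 2) * (K * ‖w‖ ^ 2) := by
    rw [h1]
    refine (Finset.sum_mul_sq_le_sq_mul_sq _ _ _).trans ?_
    rw [← h1]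
    exact mul_le_mul_of_nonneg_left (hK w) h0
  rcases (sq_nonneg ‖w‖).eq_or_lt with h3 | h3
  · rw [← h3]
    positivity
  · nlinarith

lemma sum_mul_inner_conjTranspose_mul_self (B : Matrix (Fin n) (Fin n) ℝ) (q : Fin n → E) :
    ∑ i, ∑ j, (B.conjTranspose * B) i j * inner ℝ (q i) (q j) = ∑ l, ‖∑ i, B l i • q i‖ ^ 2 := by
  simp_rw [← real_inner_self_eq_norm_sq, sum_inner, inner_sum, real_inner_smul_left,
    real_inner_smul_right, Matrix.mul_apply, Matrix.conjTranspose_apply, star_trivial,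
    Finset.sum_mul]
  rw [Finset.sum_congr rfl fun i _ => Finset.sum_comm, Finset.sum_comm]
  exact Finset.sum_congr rfl fun l _ => Finset.sum_congr rfl fun i _ =>
    Finset.sum_congr rfl fun j _ => by ring

/-- Cluster averaging is self-adjoint. This moves centering from the noise vectors to scalar
coefficients. -/
lemma sum_smul_clusterMean (x : Fin n → ℝ) (g : Fin n → E) :
    ∑ i, x i • clusterMean m σ g (σ i) = ∑ i, clusterMean m σ x (σ i) • g i := by
  simp only [clusterMean, Finset.smul_sum, Finset.sum_smul, Finset.sum_filter, smul_eq_mul,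
    Finset.mul_sum, Finset.sum_smul]
  rw [Finset.sum_comm]
  refine Finset.sum_congr rfl fun i _ => Finset.sum_congr rfl fun j _ => ?_
  by_cases h : σ i = σ j
  · simp [h, smul_smul, mul_comm]
  · simp [h, Ne.symm h]

/-- Pythagoras: `m⁻¹` times the true cluster matrix is the orthogonal projection onto vectors
constant on clusters. -/
lemma sum_sq_sub_clusterMean (hm : m ≠ 0)
    (hσ : ∀ a, ((Finset.univ.filter fun i => σ i = a).card : ℝ) = m) (x : Fin n → ℝ) :
    ∑ i, (x i - clusterMean m σ x (σ i)) ^ 2 =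
      ∑ i, x i ^ 2 - m⁻¹ * ∑ i, ∑ j, trueClusterMatrix σ i j * (x i * x j) := by
  have h1 : ∑ i, (x i - clusterMean m σ x (σ i)) * clusterMean m σ x (σ i) = 0 := by
    rw [← Finset.sum_fiberwise_of_maps_to (g := σ) (t := Finset.univ) (fun i _ => Finset.mem_univ _)]
    refine Finset.sum_eq_zero fun a _ => ?_
    have h := sum_centered_eq_zero hm hσ x a
    rw [Finset.sum_congr rfl (g := fun i => (x i - clusterMean m σ x (σ i)) * clusterMean m σ x a),
      ← Finset.sum_mul, h, zero_mul]
    intro i hi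
    rw [(Finset.mem_filter.1 hi).2]
  have h2 : ∑ i, x i * clusterMean m σ x (σ i) =
      m⁻¹ * ∑ i, ∑ j, trueClusterMatrix σ i j * (x i * x j) := by
    rw [Finset.mul_sum]
    refine Finset.sum_congr rfl fun i _ => ?_
    simp only [clusterMean, smul_eq_mul, Finset.sum_filter, Finset.mul_sum, trueClusterMatrix,
      Matrix.of_apply]
    refine Finset.sum_congr rfl fun j _ => ?_
    by_cases h : σ i = σ j
    · simp [h]; ring
    · simp [h, Ne.symm h]
  have h3 : ∑ i, (x i - clusterMean m σ x (σ i)) ^ 2 =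
      ∑ i, x i ^ 2 - ∑ i, x i * clusterMean m σ x (σ i)
        - ∑ i, (x i - clusterMean m σ x (σ i)) * clusterMean m σ x (σ i) := by
    rw [← Finset.sum_sub_distrib, ← Finset.sum_sub_distrib]
    exact Finset.sum_congr rfl fun i _ => by ring
  rw [h3, h1, h2, sub_zero]

lemma sum_trueClusterMatrix_mul (hY : IsFeasible k Y) :
    ∑ i, ∑ j, trueClusterMatrix σ i j * Y i j = n * ((n : ℝ) / k) - crossMass σ Y := by
  have h : ∀ i, ∑ j, trueClusterMatrix σ i j * Y i j =
      (n : ℝ) / k - ∑ j, if σ i = σ j then 0 else Y i j := by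
    intro i
    rw [← hY.sum_row i, ← Finset.sum_sub_distrib]
    refine Finset.sum_congr rfl fun j _ => ?_
    simp only [trueClusterMatrix, Matrix.of_apply]
    split_ifs <;> simp
  rw [Finset.sum_congr rfl fun i _ => h i, Finset.sum_sub_distrib]
  simp [crossMass]

open scoped MatrixOrder in
/-- The noise, after centering within clusters, contributes to the objective at most in proportion
to the cross-cluster mass. -/
lemma sum_mul_inner_centered_le {K : ℝ} (hK0 : 0 ≤ K) (hm : m ≠ 0) (hmk : (n : ℝ) / k = m)
    (hσ : ∀ a, ((Finset.univ.filter fun i => σ i = a).card : ℝ) = m) (hY : IsFeasible k Y)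
    {g : Fin n → E} (hK : ∀ u : E, ∑ i, inner ℝ (g i) u ^ 2 ≤ K * ‖u‖ ^ 2)
    {q : Fin n → E} (hq : ∀ i, q i = g i - clusterMean m σ g (σ i)) :
    ∑ i, ∑ j, Y i j * inner ℝ (q i) (q j) ≤ K * (m⁻¹ * crossMass σ Y) := by
  -- The Gram factorization reduces the claim to rows of `B`. The squared norms of their centered
  -- parts add up to `n - (n * m - crossMass) / m`, which is `crossMass / m`.
  obtain ⟨B, hB⟩ := CStarAlgebra.nonneg_iff_eq_star_mul_self.mp hY.psd.nonneg
  have hB' : Y = B.conjTranspose * B := hB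
  have hentry : ∀ i j, Y i j = ∑ l, B l i * B l j := by
    intro i j
    rw [hB']
    simp [Matrix.mul_apply]
  rw [hB', sum_mul_inner_conjTranspose_mul_self, ← hB']
  have h1 : ∀ l, ‖∑ i, B l i • q i‖ ^ 2 ≤
      K * ∑ i, (B l i - clusterMean m σ (B l) (σ i)) ^ 2 := by
    intro l
    have : ∑ i, B l i • q i = ∑ i, (B l i - clusterMean m σ (B l) (σ i)) • g i := by
      simp_rw [hq, smul_sub, sub_smul, Finset.sum_sub_distrib]
      rw [sum_smul_clusterMean (B l) g]
    rw [this]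
    exact norm_sq_sum_smul_le hK0 hK _
  refine (Finset.sum_le_sum fun l _ => h1 l).trans_eq ?_
  rw [← Finset.mul_sum]
  congr 1
  simp_rw [sum_sq_sub_clusterMean hm hσ]
  rw [Finset.sum_sub_distrib, ← Finset.mul_sum]
  have h2 : ∑ l, ∑ i, B l i ^ 2 = n := by
    rw [Finset.sum_comm]
    have : ∀ i, ∑ l, B l i ^ 2 = 1 := by
      intro i
      rw [← hY.diag i, hentry]
      exact Finset.sum_congr rfl fun l _ => by ring
    simp [this]
  have h3 : ∑ l, ∑ i, ∑ j, trueClusterMatrix σ i j * (B l i * B l j) =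
      n * m - crossMass σ Y := by
    rw [← hmk, ← sum_trueClusterMatrix_mul hY, Finset.sum_comm]
    refine Finset.sum_congr rfl fun i _ => ?_
    rw [Finset.sum_comm]
    refine Finset.sum_congr rfl fun j _ => ?_
    rw [hentry, Finset.mul_sum]
  rw [h2, h3]
  field_simp
  ring

lemma norm_sq_clusterMean_le {K : ℝ} (hK0 : 0 ≤ K) (hm : 0 < m)
    (hσ : ∀ a, ((Finset.univ.filter fun i => σ i = a).card : ℝ) = m)
    {g : Fin n → E} (hK : ∀ u : E, ∑ i, inner ℝ (g i) u ^ 2 ≤ K * ‖u‖ ^ 2) (a : Fin k) :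
    ‖clusterMean m σ g a‖ ^ 2 ≤ K / m := by
  have h1 : clusterMean m σ g a = ∑ i, (if σ i = a then m⁻¹ else 0) • g i := by
    rw [clusterMean, Finset.smul_sum, Finset.sum_filter]
    exact Finset.sum_congr rfl fun i _ => by split_ifs <;> simp
  rw [h1]
  refine (norm_sq_sum_smul_le hK0 hK _).trans_eq ?_
  simp only [ite_pow, ne_eq, OfNat.ofNat_ne_zero, not_false_eq_true, zero_pow]
  rw [← Finset.sum_filter, Finset.sum_const, nsmul_eq_mul, hσ]
  field_simp

/-- Lower bound for the coefficient of an entry between two different clusters with centers at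
difference `v`, where `c` and `c'` are the mean noises of the two clusters. -/
lemma coefficient_lower_bound {Δ bad : ℝ} {x v c c' : E} (hΔ : 0 < Δ) (hv : Δ ≤ ‖v‖)
    (hc : ‖c‖ ≤ Δ / 32) (hc' : ‖c'‖ ≤ Δ / 32)
    (hx : inner ℝ x c' ≤ Δ ^ 2 / 64) (hx' : -(Δ ^ 2 / 64) ≤ inner ℝ x c)
    (hlin : 4 * inner ℝ x v ≤ ‖v‖ ^ 2 / 4 + bad) :
    5 / 16 * Δ ^ 2 - bad ≤ ‖v + (c' - c)‖ ^ 2 - 4 * inner ℝ (x - c) (v + (c' - c)) := by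
  have h1 : ‖c' - c‖ ≤ Δ / 16 := (norm_sub_le _ _).trans (by linarith)
  have h2 : ‖v‖ - Δ / 16 ≤ ‖v + (c' - c)‖ := by
    have := norm_sub_le (v + (c' - c)) (c' - c)
    rw [add_sub_cancel_right] at this
    linarith
  have h3 : ‖v + (c' - c)‖ ≤ ‖v‖ + Δ / 16 := (norm_add_le _ _).trans (by linarith)
  have h4 : -(Δ / 32 * (‖v‖ + Δ / 16)) ≤ inner ℝ c (v + (c' - c)) := by
    have := neg_le_of_abs_le (abs_real_inner_le_norm c (v + (c' - c)))
    have h5 : ‖c‖ * ‖v + (c' - c)‖ ≤ Δ / 32 * (‖v‖ + Δ / 16) := by gcongr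
    linarith
  have h6 : (‖v‖ - Δ / 16) ^ 2 ≤ ‖v + (c' - c)‖ ^ 2 := by
    apply pow_le_pow_left₀ _ h2
    linarith
  have h7 : inner ℝ (x - c) (v + (c' - c)) =
      inner ℝ x v + inner ℝ x c' - inner ℝ x c - inner ℝ c (v + (c' - c)) := by
    rw [inner_sub_left, inner_add_right x, inner_sub_right x]
    ring
  rw [h7]
  -- The lower bound is a quadratic in `‖v‖` with leading coefficient `3/4`, increasing for `‖v‖ ≥
  -- Δ`; at `‖v‖ = Δ` it is `95/256 * Δ²`, above `5/16 * Δ²`, before subtracting `bad`.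
  nlinarith [mul_nonneg (sub_nonneg.2 hv) hΔ.le, mul_nonneg (sub_nonneg.2 hv) (hΔ.le.trans hv)]

/-- The inner products of a noise vector with the cluster means, from those with the sums that
leave this noise vector out. -/
lemma inner_clusterMean_bounds (hm : 0 < m) {θ : ℝ} {g : Fin n → E} (i : Fin n) (a : Fin k)
    (h : |inner ℝ (g i) (∑ j with σ j = a ∧ j ≠ i, g j)| ≤ m * θ) :
    -θ ≤ inner ℝ (g i) (clusterMean m σ g a) ∧
      (σ i ≠ a → inner ℝ (g i) (clusterMean m σ g a) ≤ θ) := by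
  obtain ⟨h1, h2⟩ := abs_le.1 h
  have hfilter : ∑ j with σ j = a ∧ j ≠ i, g j = ∑ j with σ j = a, g j - if σ i = a then g i else 0 := by
    rw [eq_sub_iff_add_eq, ← Finset.sum_filter_add_sum_filter_not (Finset.univ.filter fun j => σ j = a)
      (fun j => j ≠ i), Finset.filter_filter, Finset.filter_filter]
    congr 1
    simp only [not_not]
    by_cases hi : σ i = a
    · rw [if_pos hi, Finset.sum_eq_single i] <;> simp_all
    · rw [if_neg hi, Finset.sum_eq_zero]
      intro j hj
      simp at hj
      exact absurd (hj.2 ▸ hj.1) hi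
  rw [hfilter, inner_sub_right] at h1 h2
  simp only [clusterMean, real_inner_smul_right]
  rw [← sub_nonneg] at h1 h2 ⊢
  set X := inner ℝ (g i) (∑ j with σ j = a, g j)
  constructor
  -- In the point's own cluster the omitted term is `‖g i‖²`. It need not be small, but its sign is
  -- favorable, and only a lower bound is needed there.
  · have h3 : 0 ≤ inner ℝ (g i) (if σ i = a then g i else 0) := by
      split_ifs
      · exact real_inner_self_nonneg
      · simp
    rw [sub_neg_eq_add, ← mul_le_mul_iff_right₀ hm]
    rw [mul_zero, mul_add, mul_inv_cancel_left₀ hm.ne']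
    linarith
  · intro hi
    rw [if_neg hi, inner_zero_right] at h2
    rw [← mul_le_mul_iff_right₀ hm, mul_inv_cancel_left₀ hm.ne']
    linarith

/-- On the event that the noise is well behaved, no feasible matrix that is at least as good as the
true clustering puts much mass on pairs from different clusters. -/
theorem crossMass_le {Δ K : ℝ} {bad : Fin n → Fin k → ℝ} (hm : 0 < m) (hmk : (n : ℝ) / k = m)
    (hσ : ∀ a, ((Finset.univ.filter fun i => σ i = a).card : ℝ) = m) (hY : IsFeasible k Y)
    {μ : Fin k → E} {g : Fin n → E} (hΔ : 0 < Δ) (hsep : ∀ a b, a ≠ b → Δ ≤ ‖μ b - μ a‖)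
    (hK0 : 0 ≤ K) (hK : ∀ u : E, ∑ i, inner ℝ (g i) u ^ 2 ≤ K * ‖u‖ ^ 2)
    (hKm : K / m ≤ (Δ / 32) ^ 2)
    (hcross : ∀ i a, |inner ℝ (g i) (∑ j with σ j = a ∧ j ≠ i, g j)| ≤ m * (Δ ^ 2 / 64))
    (hbad : ∀ i b, 0 ≤ bad i b)
    (hlin : ∀ i b, σ i ≠ b →
      4 * inner ℝ (g i) (μ b - μ (σ i)) ≤ ‖μ b - μ (σ i)‖ ^ 2 / 4 + bad i b)
    (hopt : ∑ i, ∑ j, Y i j * ‖(μ (σ i) + g i) - (μ (σ j) + g j)‖ ^ 2 ≤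
      ∑ i, ∑ j, trueClusterMatrix σ i j * ‖(μ (σ i) + g i) - (μ (σ j) + g j)‖ ^ 2) :
    Δ ^ 2 / 4 * crossMass σ Y ≤ m * ∑ i, ∑ b, bad i b := by
  set c := clusterMean m σ g with hc
  set ν : Fin k → E := fun a => μ a + c a with hν
  set q : Fin n → E := fun i => g i - c (σ i) with hq
  have hpoint : ∀ i, μ (σ i) + g i = ν (σ i) + q i := fun i => by simp only [hν, hq]; abel
  simp only [hpoint] at hopt
  have hobj := objective_sub hm.ne' hmk hσ hY ν g q fun i => rfl
  have hquad := sum_mul_inner_centered_le hK0 hm.ne' hmk hσ hY hK (q := q) fun i => rfl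
  have hcn : ∀ a, ‖c a‖ ≤ Δ / 32 := fun a =>
    abs_le_of_sq_le_sq' ((norm_sq_clusterMean_le hK0 hm hσ hK a).trans hKm) (by positivity) |>.2
  have hterm : ∀ i j, (if σ i = σ j then 0 else Y i j) * (5 / 16 * Δ ^ 2) - bad i (σ j) ≤
      Y i j * (‖ν (σ j) - ν (σ i)‖ ^ 2 - 4 * inner ℝ (q i) (ν (σ j) - ν (σ i))) := by
    intro i j
    split_ifs with hij
    · simp [hij, hbad]
    · have h1 := (inner_clusterMean_bounds hm i (σ i) (hcross i _)).1
      have h2 := (inner_clusterMean_bounds hm i (σ j) (hcross i _)).2 hij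
      have h3 := coefficient_lower_bound hΔ (hsep _ _ hij) (hcn (σ i)) (hcn (σ j)) h2 h1
        (hlin i _ hij)
      have h4 : ν (σ j) - ν (σ i) = μ (σ j) - μ (σ i) + (c (σ j) - c (σ i)) := by
        simp only [hν]; abel
      rw [h4]
      have h5 := mul_le_mul_of_nonneg_left h3 (hY.nonneg i j)
      -- Bounding `Y i j` by 1 makes the total bad contribution independent of `Y`.
      have h6 := mul_le_mul_of_nonneg_right (hY.le_one i j) (hbad i (σ j))
      linarith
  have hsum := Finset.sum_le_sum fun i (_ : i ∈ Finset.univ) =>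
    Finset.sum_le_sum fun j (_ : j ∈ Finset.univ) => hterm i j
  have hblock : ∀ i, ∑ j, bad i (σ j) = m * ∑ b, bad i b := by
    intro i
    rw [← Finset.sum_fiberwise_of_maps_to (g := σ) (t := Finset.univ) (fun i _ => Finset.mem_univ _),
      Finset.mul_sum]
    refine Finset.sum_congr rfl fun b _ => ?_
    rw [Finset.sum_congr rfl (g := fun _ => bad i b), Finset.sum_const, nsmul_eq_mul, hσ]
    intro j hj
    rw [(Finset.mem_filter.1 hj).2]
  simp only [Finset.sum_sub_distrib, hblock, ← Finset.mul_sum, ← Finset.sum_mul] at hsum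
  have hK' : K * (m⁻¹ * crossMass σ Y) ≤ (Δ / 32) ^ 2 * crossMass σ Y := by
    rw [← mul_assoc, ← div_eq_mul_inv]
    exact mul_le_mul_of_nonneg_right hKm hY.crossMass_nonneg
  have hcm := hY.crossMass_nonneg (σ := σ)
  rw [← crossMass] at hsum
  -- The quadratic noise costs `2 * (Δ/32)²` per unit of cross mass, and `5/16 - 2/1024 ≥ 1/4`.
  nlinarith [mul_nonneg (sq_nonneg Δ) hcm]

end Deterministic

/-! ### Exponential moments of sub-Gaussian vectors. -/

section Probability

lemma exp_le_add_exp_sq (x : ℝ) : Real.exp x ≤ x + Real.exp (x ^ 2) := by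
  have h := Real.add_one_le_exp (x ^ 2)
  rcases le_or_gt |x| 1 with hx | hx
  · have := (abs_le.1 (Real.abs_exp_sub_one_sub_id_le hx)).2
    linarith
  · rcases lt_abs.1 hx with hx | hx
    · have : Real.exp x ≤ Real.exp (x ^ 2) := Real.exp_le_exp.2 (by nlinarith)
      linarith
    · have : Real.exp x ≤ 1 := Real.exp_le_one_iff.2 (by linarith)
      nlinarith

variable {Ω : Type*} [MeasurableSpace Ω] {P : Measure Ω}

lemma ofReal_exp_rpow (x p : ℝ) :
    ENNReal.ofReal (Real.exp x) ^ p = ENNReal.ofReal (Real.exp (p * x)) := by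
  rw [ENNReal.ofReal_rpow_of_pos (Real.exp_pos _), ← Real.exp_mul, mul_comm]

lemma ofReal_exp_add (x y : ℝ) :
    ENNReal.ofReal (Real.exp (x + y)) = ENNReal.ofReal (Real.exp x) * ENNReal.ofReal (Real.exp y) := by
  rw [Real.exp_add, ENNReal.ofReal_mul (Real.exp_pos _).le]

lemma two_rpow_le_exp {p : ℝ} (hp : 0 ≤ p) : (2 : ℝ≥0∞) ^ p ≤ ENNReal.ofReal (Real.exp p) := by
  have h : (2 : ℝ≥0∞) = ENNReal.ofReal 2 := by simp
  rw [h, ENNReal.ofReal_rpow_of_pos two_pos]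
  refine ENNReal.ofReal_le_ofReal ?_
  rw [← Real.exp_one_rpow p]
  exact Real.rpow_le_rpow two_pos.le (by linarith [Real.add_one_le_exp (1 : ℝ)]) hp

lemma lintegral_rpow_le [IsProbabilityMeasure P] {f : Ω → ℝ≥0∞} (hf : Measurable f) {p : ℝ}
    (hp0 : 0 < p) (hp1 : p ≤ 1) : ∫⁻ ω, f ω ^ p ∂P ≤ (∫⁻ ω, f ω ∂P) ^ p := by
  have h := eLpNorm'_le_eLpNorm'_of_exponent_le hp0 hp1 P hf.aestronglyMeasurable
  simp only [eLpNorm', enorm_eq_self, ENNReal.rpow_one, div_one] at h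
  rwa [one_div, ENNReal.rpow_inv_le_iff hp0] at h

lemma lintegral_exp_mul_le [IsProbabilityMeasure P] {f : Ω → ℝ} (hf : Measurable f) {p : ℝ}
    (hp0 : 0 ≤ p) (hp1 : p ≤ 1) :
    ∫⁻ ω, ENNReal.ofReal (Real.exp (p * f ω)) ∂P
      ≤ (∫⁻ ω, ENNReal.ofReal (Real.exp (f ω)) ∂P) ^ p := by
  rcases hp0.eq_or_lt with rfl | hp0
  · simp
  simp_rw [← ofReal_exp_rpow]
  exact lintegral_rpow_le (by fun_prop) hp0 hp1

lemma integrable_exp_of_lintegral_ne_top {f : Ω → ℝ} (hf : Measurable f)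
    (h : ∫⁻ ω, ENNReal.ofReal (Real.exp (f ω)) ∂P ≠ ∞) :
    Integrable (fun ω => Real.exp (f ω)) P := by
  refine ⟨by fun_prop, ?_⟩
  rw [hasFiniteIntegral_iff_ofReal (ae_of_all _ fun ω => (Real.exp_pos _).le)]
  exact h.lt_top

/-- For `t² ≤ 1`, integrating `exp_le_add_exp_sq` kills the linear term and Jensen's inequality
bounds the rest by `2 ^ (t²)`. For larger `t`, `tX ≤ t²/2 + X²/2` suffices without centering. -/
lemma lintegral_exp_mul_le_of_centered [IsProbabilityMeasure P] {X : Ω → ℝ} (hX : Measurable X)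
    (h2 : ∫⁻ ω, ENNReal.ofReal (Real.exp (X ω ^ 2)) ∂P ≤ 2) (h0 : ∫ ω, X ω ∂P = 0) (t : ℝ) :
    ∫⁻ ω, ENNReal.ofReal (Real.exp (t * X ω)) ∂P ≤ ENNReal.ofReal (Real.exp (t ^ 2)) := by
  rcases le_or_gt (t ^ 2) 1 with ht | ht
  · have hsq : ∫⁻ ω, ENNReal.ofReal (Real.exp (t ^ 2 * X ω ^ 2)) ∂P ≤
        ENNReal.ofReal (Real.exp (t ^ 2)) :=
      (lintegral_exp_mul_le (by fun_prop) (sq_nonneg t) ht).trans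
        ((ENNReal.rpow_le_rpow h2 (sq_nonneg t)).trans (two_rpow_le_exp (sq_nonneg t)))
    have hint : Integrable (fun ω => Real.exp (t ^ 2 * X ω ^ 2)) P :=
      integrable_exp_of_lintegral_ne_top (by fun_prop)
        (ne_top_of_le_ne_top ENNReal.ofReal_ne_top hsq)
    have hint1 : Integrable (fun ω => Real.exp (X ω ^ 2)) P :=
      integrable_exp_of_lintegral_ne_top (by fun_prop) (ne_top_of_le_ne_top (by simp) h2)
    have hintX : Integrable X P := by
      refine hint1.mono' hX.aestronglyMeasurable (ae_of_all _ fun ω => ?_)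
      have := Real.add_one_le_exp (X ω ^ 2)
      rw [Real.norm_eq_abs, abs_le]
      constructor <;> nlinarith [sq_nonneg (X ω + 1), sq_nonneg (X ω - 1)]
    have hbd : ∀ ω, Real.exp (t * X ω) ≤ t * X ω + Real.exp (t ^ 2 * X ω ^ 2) := by
      intro ω
      rw [← mul_pow]
      exact exp_le_add_exp_sq _
    have hintE : Integrable (fun ω => Real.exp (t * X ω)) P := by
      refine ((hintX.const_mul t).add hint).mono' (by fun_prop) (ae_of_all _ fun ω => ?_)
      rw [Real.norm_eq_abs, Real.abs_exp]
      exact hbd ω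
    rw [← ofReal_integral_eq_lintegral_ofReal hint (ae_of_all _ fun ω => (Real.exp_pos _).le)] at hsq
    rw [← ofReal_integral_eq_lintegral_ofReal hintE (ae_of_all _ fun ω => (Real.exp_pos _).le)]
    refine le_trans (ENNReal.ofReal_le_ofReal ?_) hsq
    refine (integral_mono hintE ((hintX.const_mul t).add hint) hbd).trans_eq ?_
    simp only [Pi.add_apply]
    rw [integral_add (hintX.const_mul t) hint, integral_const_mul, h0, mul_zero, zero_add]
  · have hbd : ∀ ω, ENNReal.ofReal (Real.exp (t * X ω)) ≤
        ENNReal.ofReal (Real.exp (t ^ 2 / 2)) *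
          ENNReal.ofReal (Real.exp (1 / 2 * X ω ^ 2)) := by
      intro ω
      rw [← ofReal_exp_add]
      refine ENNReal.ofReal_le_ofReal (Real.exp_le_exp.2 ?_)
      nlinarith [sq_nonneg (t - X ω)]
    refine (lintegral_mono hbd).trans ?_
    rw [lintegral_const_mul _ (by fun_prop)]
    have h3 : ∫⁻ ω, ENNReal.ofReal (Real.exp (1 / 2 * X ω ^ 2)) ∂P ≤
        ENNReal.ofReal (Real.exp (t ^ 2 / 2)) :=
      (lintegral_exp_mul_le (by fun_prop) (by norm_num) (by norm_num)).trans
        ((ENNReal.rpow_le_rpow h2 (by norm_num)).trans ((two_rpow_le_exp (by norm_num)).trans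
          (ENNReal.ofReal_le_ofReal (Real.exp_le_exp.2 (by linarith)))))
    refine (mul_le_mul_right h3 _).trans_eq ?_
    rw [← ofReal_exp_add, add_halves]

variable {d : ℕ}

/-- All marginals of `x` along vectors of norm at most one are sub-Gaussian at scale `T`. -/
def SubGaussianVec (P : Measure Ω) (x : Ω → EuclideanSpace ℝ (Fin d)) (T : ℝ) : Prop :=
  ∀ u : EuclideanSpace ℝ (Fin d), ‖u‖ ≤ 1 →
    ∫⁻ ω, ENNReal.ofReal (Real.exp ((inner ℝ (x ω) u / T) ^ 2)) ∂P ≤ 2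

/-- The strict inequality `τ < T` provides an admissible scale below `T`, so attainment of the
infimum need not be discussed. -/
lemma subGaussianVec_of_psi2NormVec_le [IsProbabilityMeasure P] {τ T : ℝ} (hτ : 0 ≤ τ)
    (hT : τ < T) {x : Ω → EuclideanSpace ℝ (Fin d)} (hx : psi2NormVec P x ≤ ENNReal.ofReal τ) :
    SubGaussianVec P x T := by
  have hT0 : 0 < T := hτ.trans_lt hT
  have hunit : ∀ u : EuclideanSpace ℝ (Fin d), ‖u‖ = 1 →
      ∫⁻ ω, ENNReal.ofReal (Real.exp ((inner ℝ (x ω) u / T) ^ 2)) ∂P ≤ 2 := by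
    intro u hu
    have h1 : psi2Norm P (fun ω => inner ℝ (x ω) u) < ENNReal.ofReal T := by
      refine lt_of_le_of_lt (le_trans ?_ hx) ((ENNReal.ofReal_lt_ofReal_iff hT0).2 hT)
      exact le_iSup₂_of_le u (by simpa using hu) le_rfl
    obtain ⟨r, ⟨t, ht0, rfl, ht⟩, hr⟩ := sInf_lt_iff.1 h1
    have htT : t < T := (ENNReal.ofReal_lt_ofReal_iff hT0).1 hr
    refine le_trans (lintegral_mono fun ω => ENNReal.ofReal_le_ofReal (Real.exp_le_exp.2 ?_)) ht
    rw [div_pow]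
    gcongr
  intro u hu
  rcases eq_or_ne u 0 with rfl | hu0
  · simp
  · have hn : 0 < ‖u‖ := norm_pos_iff.2 hu0
    refine le_trans (lintegral_mono fun ω => ENNReal.ofReal_le_ofReal (Real.exp_le_exp.2 ?_))
      (hunit (‖u‖⁻¹ • u) (by rw [norm_smul, norm_inv, norm_norm, inv_mul_cancel₀ hn.ne']))
    rw [real_inner_smul_right, mul_div_assoc, mul_pow]
    refine le_mul_of_one_le_left (sq_nonneg _) (one_le_pow₀ ((one_le_inv₀ hn).2 hu))

variable {ι : Type*} {g : ι → Ω → EuclideanSpace ℝ (Fin d)} {T : ℝ}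

lemma lintegral_exp_sum_inner_sq_le (hmeas : ∀ i, Measurable (g i)) (hind : iIndepFun g P)
    (hsub : ∀ i, SubGaussianVec P (g i) T) (S : Finset ι) {u : EuclideanSpace ℝ (Fin d)}
    (hu : ‖u‖ ≤ 1) :
    ∫⁻ ω, ENNReal.ofReal (Real.exp (∑ i ∈ S, (inner ℝ (g i ω) u / T) ^ 2)) ∂P ≤ 2 ^ S.card := by
  have h1 : ∀ ω, ENNReal.ofReal (Real.exp (∑ i ∈ S, (inner ℝ (g i ω) u / T) ^ 2)) =
      ∏ i ∈ S, ENNReal.ofReal (Real.exp ((inner ℝ (g i ω) u / T) ^ 2)) := by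
    intro ω
    rw [Real.exp_sum, ENNReal.ofReal_prod_of_nonneg fun i _ => (Real.exp_pos _).le]
  simp_rw [h1]
  have hind' := hind.comp (fun _ x => ENNReal.ofReal (Real.exp ((inner ℝ x u / T) ^ 2)))
    fun i => by fun_prop
  have h2 := lintegral_prod_eq_prod_lintegral_of_indepFun S _ hind' fun i => by
    have := hmeas i
    fun_prop
  simp only [Function.comp_apply] at h2
  rw [h2]
  exact (Finset.prod_le_prod' fun i _ => hsub i u hu).trans_eq (by simp)

/-- Exponential moments of `∑ ⟨g i, u⟩²` hold uniformly in `u`: by convexity the supremum over the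
unit ball is dominated by the average over the ball of radius two. -/
lemma exists_uniform_exp_bound (hmeas : ∀ i, Measurable (g i)) [IsProbabilityMeasure P]
    (hind : iIndepFun g P)
    (hsub : ∀ i, SubGaussianVec P (g i) T) (S : Finset ι) :
    ∃ W : Ω → ℝ≥0∞, Measurable W ∧ ∫⁻ ω, W ω ∂P ≤ 2 ^ (S.card + d) ∧
      ∀ ω (u : EuclideanSpace ℝ (Fin d)), ‖u‖ ≤ 1 →
        ENNReal.ofReal (Real.exp (∑ i ∈ S, (inner ℝ (g i ω) u / (2 * T)) ^ 2)) ≤ W ω := by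
  set V : Measure (EuclideanSpace ℝ (Fin d)) := volume
  set q : Ω → EuclideanSpace ℝ (Fin d) → ℝ := fun ω v =>
    ∑ i ∈ S, (inner ℝ (g i ω) v / (2 * T)) ^ 2 with hq
  set F : Ω → EuclideanSpace ℝ (Fin d) → ℝ≥0∞ := fun ω v => ENNReal.ofReal (Real.exp (q ω v))
    with hF
  have hFm : Measurable (Function.uncurry F) := by
    simp only [hF, hq, Function.uncurry_def]
    fun_prop
  have hFω : ∀ ω, Measurable (F ω) := fun ω => by
    simp only [hF, hq]
    fun_prop
  set c := V (Metric.ball 0 1)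
  have hc0 : c ≠ 0 := (Metric.measure_ball_pos V 0 one_pos).ne'
  have hctop : c ≠ ∞ := measure_ball_lt_top.ne
  have hball : V (Metric.ball 0 2) = 2 ^ d * c := by
    have := Measure.addHaar_ball_mul_of_pos V (0 : EuclideanSpace ℝ (Fin d)) (two_pos) 1
    rw [mul_one] at this
    rw [this, finrank_euclideanSpace_fin]
    congr 1
    rw [ENNReal.ofReal_pow two_pos.le]
    simp
  refine ⟨fun ω => c⁻¹ * ∫⁻ v in Metric.ball 0 2, F ω v ∂V,
    (Measurable.lintegral_prod_right hFm).const_mul _, ?_, ?_⟩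
  · rw [lintegral_const_mul _ (Measurable.lintegral_prod_right hFm),
      lintegral_lintegral_swap hFm.aemeasurable]
    have h1 : ∫⁻ v in Metric.ball 0 2, ∫⁻ ω, F ω v ∂P ∂V ≤ ∫⁻ v in Metric.ball 0 2, 2 ^ S.card ∂V := by
      refine setLIntegral_mono measurable_const fun v hv => ?_
      -- The scale `2 * T` compensates for radius two: halving `v` returns to the unit ball at scale
      -- `T`.
      have hv' : ‖(2⁻¹ : ℝ) • v‖ ≤ 1 := by
        rw [mem_ball_zero_iff] at hv
        rw [norm_smul]
        norm_num
        linarith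
      refine le_trans (le_of_eq ?_) (lintegral_exp_sum_inner_sq_le hmeas hind hsub S hv')
      simp only [hF, hq, real_inner_smul_right]
      refine lintegral_congr fun ω => ?_
      congr 3
      ext i
      ring
    refine (mul_le_mul_right h1 _).trans_eq ?_
    rw [setLIntegral_const, hball, pow_add]
    calc c⁻¹ * (2 ^ S.card * (2 ^ d * c)) = (c⁻¹ * c) * (2 ^ S.card * 2 ^ d) := by ring
      _ = _ := by rw [ENNReal.inv_mul_cancel hc0 hctop, one_mul]
  · intro ω u hu
    -- By the parallelogram law the quadratic form at `u` is at most its average at `u ± v`.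
    -- Integrating over `v` in the unit ball costs only the volume ratio `2 ^ d`, in place of a
    -- union bound over a net.
    have hconv : ∀ v, 2 * F ω u ≤ F ω (u + v) + F ω (u - v) := by
      intro v
      simp only [hF]
      rw [two_mul, ← ENNReal.ofReal_add (Real.exp_pos _).le (Real.exp_pos _).le,
        ← ENNReal.ofReal_add (Real.exp_pos _).le (Real.exp_pos _).le]
      refine ENNReal.ofReal_le_ofReal ?_
      have hpar : q ω (u + v) + q ω (u - v) = 2 * q ω u + 2 * q ω v := by
        simp only [hq, inner_add_right, inner_sub_right, Finset.mul_sum]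
        rw [← Finset.sum_add_distrib, ← Finset.sum_add_distrib]
        exact Finset.sum_congr rfl fun i _ => by ring
      have hqv : 0 ≤ q ω v := Finset.sum_nonneg fun i _ => sq_nonneg _
      have h1 : Real.exp (q ω u) ≤ Real.exp (q ω (u + v) / 2 + q ω (u - v) / 2) :=
        Real.exp_le_exp.2 (by linarith)
      have h2 : Real.exp (q ω (u + v)) = Real.exp (q ω (u + v) / 2) ^ 2 := by
        rw [← Real.exp_nat_mul]; congr 1; push_cast; ring
      have h3 : Real.exp (q ω (u - v)) = Real.exp (q ω (u - v) / 2) ^ 2 := by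
        rw [← Real.exp_nat_mul]; congr 1; push_cast; ring
      rw [Real.exp_add] at h1
      rw [h2, h3]
      nlinarith [sq_nonneg (Real.exp (q ω (u + v) / 2) - Real.exp (q ω (u - v) / 2))]
    have hsubset : Metric.ball u 1 ⊆ Metric.ball 0 2 :=
      Metric.ball_subset_ball' (by rw [dist_zero_right]; linarith)
    have hplus : ∫⁻ v in Metric.ball 0 1, F ω (u + v) ∂V ≤ ∫⁻ v in Metric.ball 0 2, F ω v ∂V := by
      have h := (measurePreserving_add_left V u).setLIntegral_comp_preimage
        (s := Metric.ball u 1) measurableSet_ball (hFω ω)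
      have hpre : (fun v => u + v) ⁻¹' Metric.ball u 1 = Metric.ball 0 1 := by
        ext v; simp [dist_eq_norm]
      rw [hpre] at h
      rw [h]
      exact lintegral_mono_set hsubset
    have hminus : ∫⁻ v in Metric.ball 0 1, F ω (u - v) ∂V ≤ ∫⁻ v in Metric.ball 0 2, F ω v ∂V := by
      have h := (Measure.measurePreserving_sub_left V u).setLIntegral_comp_preimage
        (s := Metric.ball u 1) measurableSet_ball (hFω ω)
      have hpre : (fun v => u - v) ⁻¹' Metric.ball u 1 = Metric.ball 0 1 := by
        ext v; simp [dist_eq_norm]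
      rw [hpre] at h
      rw [h]
      exact lintegral_mono_set hsubset
    have h4 : 2 * (F ω u * c) ≤ 2 * ∫⁻ v in Metric.ball 0 2, F ω v ∂V := by
      calc 2 * (F ω u * c) = ∫⁻ v in Metric.ball 0 1, 2 * F ω u ∂V := by
            rw [setLIntegral_const]; ring
        _ ≤ ∫⁻ v in Metric.ball 0 1, (F ω (u + v) + F ω (u - v)) ∂V := lintegral_mono hconv
        _ = ∫⁻ v in Metric.ball 0 1, F ω (u + v) ∂V + ∫⁻ v in Metric.ball 0 1, F ω (u - v) ∂V :=
            lintegral_add_left ((hFω ω).comp (by fun_prop)) _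
        _ ≤ _ := by rw [two_mul]; exact add_le_add hplus hminus
    have h5 := (ENNReal.mul_le_mul_iff_right two_ne_zero ENNReal.ofNat_ne_top).1 h4
    calc F ω u = c⁻¹ * (F ω u * c) := by
          rw [mul_left_comm, ENNReal.inv_mul_cancel hc0 hctop, mul_one]
      _ ≤ _ := mul_le_mul_right h5 _

lemma lintegral_exp_norm_sq_le (hmeas : ∀ i, Measurable (g i)) [IsProbabilityMeasure P]
    (hind : iIndepFun g P) (hsub : ∀ i, SubGaussianVec P (g i) T) (i : ι) :
    ∫⁻ ω, ENNReal.ofReal (Real.exp ((‖g i ω‖ / (2 * T)) ^ 2)) ∂P ≤ 2 ^ (1 + d) := by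
  obtain ⟨W, -, hWint, hW⟩ := exists_uniform_exp_bound hmeas hind hsub {i}
  refine (lintegral_mono fun ω => ?_).trans hWint
  -- The direction may depend on `ω` because `W` dominates all directions at once.
  have h := hW ω (‖g i ω‖⁻¹ • g i ω) (by
    rw [norm_smul, norm_inv, norm_norm]; exact inv_mul_le_one)
  rw [Finset.sum_singleton, real_inner_smul_right, real_inner_self_eq_norm_sq] at h
  convert! h using 6
  rcases eq_or_ne ‖g i ω‖ 0 with h0 | h0
  · simp [h0]
  · field_simp

/-- The Bochner integral of a non-integrable function is 0 by convention, so integrability must be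
extracted from the sub-Gaussian bound before the mean can pass through the inner product. -/
lemma integral_inner_eq_zero (hmeas : ∀ i, Measurable (g i)) [IsProbabilityMeasure P]
    (hind : iIndepFun g P) (hsub : ∀ i, SubGaussianVec P (g i) T) (hT : 0 < T)
    (h0 : ∀ i, ∫ ω, g i ω ∂P = 0) (i : ι) (u : EuclideanSpace ℝ (Fin d)) :
    ∫ ω, inner ℝ (g i ω) u ∂P = 0 := by
  have hm := hmeas i
  have hexp : Integrable (fun ω => Real.exp ((‖g i ω‖ / (2 * T)) ^ 2)) P :=
    integrable_exp_of_lintegral_ne_top (by fun_prop) (ne_top_of_le_ne_top (by simp)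
      (lintegral_exp_norm_sq_le hmeas hind hsub i))
  have hint : Integrable (g i) P := by
    refine (hexp.const_mul (2 * T)).mono' hm.aestronglyMeasurable (ae_of_all _ fun ω => ?_)
    have h1 := Real.add_one_le_exp ((‖g i ω‖ / (2 * T)) ^ 2)
    have h2 : ‖g i ω‖ / (2 * T) ≤ Real.exp ((‖g i ω‖ / (2 * T)) ^ 2) := by
      nlinarith [sq_nonneg (‖g i ω‖ / (2 * T) - 1)]
    rwa [div_le_iff₀' (by positivity)] at h2
  simp_rw [real_inner_comm u]
  rw [integral_inner hint, h0, inner_zero_right]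

lemma lintegral_exp_inner_sum_le (hmeas : ∀ i, Measurable (g i)) [IsProbabilityMeasure P]
    (hind : iIndepFun g P) (hsub : ∀ i, SubGaussianVec P (g i) T) (hT : 0 < T)
    (h0 : ∀ i, ∫ ω, g i ω ∂P = 0) (S : Finset ι) (v : EuclideanSpace ℝ (Fin d)) :
    ∫⁻ ω, ENNReal.ofReal (Real.exp (inner ℝ (∑ j ∈ S, g j ω) v)) ∂P ≤
      ENNReal.ofReal (Real.exp (S.card * (T * ‖v‖) ^ 2)) := by
  have h1 : ∀ ω, ENNReal.ofReal (Real.exp (inner ℝ (∑ j ∈ S, g j ω) v)) =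
      ∏ i ∈ S, ENNReal.ofReal (Real.exp (inner ℝ (g i ω) v)) := by
    intro ω
    rw [sum_inner, Real.exp_sum, ENNReal.ofReal_prod_of_nonneg fun i _ => (Real.exp_pos _).le]
  simp_rw [h1]
  have hind' := hind.comp (fun _ x => ENNReal.ofReal (Real.exp (inner ℝ x v))) fun i => by fun_prop
  have h2 := lintegral_prod_eq_prod_lintegral_of_indepFun S _ hind' fun i => by
    have := hmeas i
    fun_prop
  simp only [Function.comp_apply] at h2
  rw [h2]
  have h3 : ∀ i, ∫⁻ ω, ENNReal.ofReal (Real.exp (inner ℝ (g i ω) v)) ∂P ≤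
      ENNReal.ofReal (Real.exp ((T * ‖v‖) ^ 2)) := by
    intro i
    have hm := hmeas i
    set e := ‖v‖⁻¹ • v with he
    have he1 : ‖e‖ ≤ 1 := by
      rw [he, norm_smul, norm_inv, norm_norm]; exact inv_mul_le_one
    have hint : ∫ ω, inner ℝ (g i ω) e / T ∂P = 0 := by
      rw [integral_div, integral_inner_eq_zero hmeas hind hsub hT h0, zero_div]
    have h := lintegral_exp_mul_le_of_centered (X := fun ω => inner ℝ (g i ω) e / T)
      (by fun_prop) (hsub i e he1) hint (T * ‖v‖)
    refine le_trans (le_of_eq (lintegral_congr fun ω => ?_)) h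
    rw [he, real_inner_smul_right]
    congr 2
    rcases eq_or_ne v 0 with rfl | hv
    · simp
    · have := norm_ne_zero_iff.2 hv
      field_simp
  refine (Finset.prod_le_prod' fun i _ => h3 i).trans_eq ?_
  rw [Finset.prod_const, ← ENNReal.ofReal_pow (Real.exp_pos _).le, ← Real.exp_nat_mul]

/-- Conditionally on `g i`, the independent sum has a Gaussian-type moment bound in `‖g i‖²`. The
condition `ht` makes its coefficient at most 1, so Jensen's inequality applies to the exponential
moment of `‖g i‖²`. -/
lemma lintegral_exp_inner_noise_le (hmeas : ∀ i, Measurable (g i)) [IsProbabilityMeasure P]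
    (hind : iIndepFun g P) (hsub : ∀ i, SubGaussianVec P (g i) T) (hT : 0 < T)
    (h0 : ∀ i, ∫ ω, g i ω ∂P = 0) {S : Finset ι} {i : ι} (hi : i ∉ S) {t m : ℝ}
    (hS : (S.card : ℝ) ≤ m) (ht : 4 * (t * T ^ 2) ^ 2 * m ≤ 1) (hd : 1 ≤ d) :
    ∫⁻ ω, ENNReal.ofReal (Real.exp (t * inner ℝ (g i ω) (∑ j ∈ S, g j ω))) ∂P ≤
      ENNReal.ofReal (Real.exp (8 * (t * T ^ 2) ^ 2 * m * d)) := by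
  have hm := hmeas i
  have hm0 : 0 ≤ m := (Nat.cast_nonneg _).trans hS
  have hSm : Measurable (∑ j ∈ S, g j) := by
    simpa only [← Finset.sum_apply] using Finset.measurable_sum S fun j _ => hmeas j
  have hindep := (indepFun_iff_map_prod_eq_prod_map_map hm.aemeasurable hSm.aemeasurable).1
    (hind.indepFun_finsetSum_of_notMem hmeas hi).symm
  have hfm : Measurable fun p : EuclideanSpace ℝ (Fin d) × EuclideanSpace ℝ (Fin d) =>
      ENNReal.ofReal (Real.exp (t * inner ℝ p.1 p.2)) := by fun_prop
  have h1 : ∫⁻ ω, ENNReal.ofReal (Real.exp (t * inner ℝ (g i ω) (∑ j ∈ S, g j ω))) ∂P =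
      ∫⁻ x, ∫⁻ y, ENNReal.ofReal (Real.exp (t * inner ℝ x y)) ∂(P.map (∑ j ∈ S, g j))
        ∂(P.map (g i)) := by
    rw [← lintegral_prod _ hfm.aemeasurable, ← hindep, lintegral_map hfm (hm.prodMk hSm)]
    simp
  have h2 : ∀ x : EuclideanSpace ℝ (Fin d),
      ∫⁻ y, ENNReal.ofReal (Real.exp (t * inner ℝ x y)) ∂(P.map (∑ j ∈ S, g j)) ≤
        ENNReal.ofReal (Real.exp (4 * (t * T ^ 2) ^ 2 * m * (‖x‖ / (2 * T)) ^ 2)) := by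
    intro x
    rw [lintegral_map (by fun_prop) hSm]
    have h := lintegral_exp_inner_sum_le hmeas hind hsub hT h0 S (t • x)
    refine le_trans (le_of_eq (lintegral_congr fun ω => ?_)) (h.trans
      (ENNReal.ofReal_le_ofReal (Real.exp_le_exp.2 ?_)))
    · rw [real_inner_smul_right, real_inner_comm, Finset.sum_apply]
    · rw [norm_smul, Real.norm_eq_abs, mul_pow, mul_pow, sq_abs]
      have : 4 * (t * T ^ 2) ^ 2 * m * (‖x‖ / (2 * T)) ^ 2 = m * (T ^ 2 * (t ^ 2 * ‖x‖ ^ 2)) := by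
        field_simp
        ring
      rw [this]
      exact mul_le_mul_of_nonneg_right hS (by positivity)
  rw [h1]
  refine (lintegral_mono h2).trans ?_
  rw [lintegral_map (by fun_prop) hm]
  refine (lintegral_exp_mul_le (f := fun ω => (‖g i ω‖ / (2 * T)) ^ 2) (by fun_prop)
    (by positivity) ht).trans ?_
  refine (ENNReal.rpow_le_rpow (lintegral_exp_norm_sq_le hmeas hind hsub i) (by positivity)).trans ?_
  rw [← ENNReal.rpow_natCast, ← ENNReal.rpow_mul]
  refine (two_rpow_le_exp (by positivity)).trans (ENNReal.ofReal_le_ofReal (Real.exp_le_exp.2 ?_))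
  push_cast
  have hd' : (1 : ℝ) ≤ d := by exact_mod_cast hd
  have : 0 ≤ (t * T ^ 2) ^ 2 * m := by positivity
  nlinarith

/-- Markov's inequality for exponential moments. -/
lemma measure_gt_le_exp {f : Ω → ℝ} (hf : Measurable f) {a x : ℝ}
    (h : ∫⁻ ω, ENNReal.ofReal (Real.exp (f ω)) ∂P ≤ ENNReal.ofReal (Real.exp a)) :
    P {ω | x < f ω} ≤ ENNReal.ofReal (Real.exp (a - x)) := by
  have h1 : P {ω | x < f ω} ≤ P {ω | ENNReal.ofReal (Real.exp x) ≤ ENNReal.ofReal (Real.exp (f ω))} :=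
    measure_mono fun ω hω => ENNReal.ofReal_le_ofReal (Real.exp_le_exp.2 (le_of_lt hω))
  refine h1.trans ((meas_ge_le_lintegral_div (by fun_prop) (by simp [Real.exp_pos])
    ENNReal.ofReal_ne_top).trans ?_)
  rw [Real.exp_sub, ENNReal.ofReal_div_of_pos (Real.exp_pos _)]
  exact ENNReal.div_le_div_right h _

lemma measure_abs_inner_noise_gt_le (hmeas : ∀ i, Measurable (g i)) [IsProbabilityMeasure P]
    (hind : iIndepFun g P) (hsub : ∀ i, SubGaussianVec P (g i) T) (hT : 0 < T)
    (h0 : ∀ i, ∫ ω, g i ω ∂P = 0) {S : Finset ι} {i : ι} (hi : i ∉ S) {t m : ℝ} (ht0 : 0 < t)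
    (hS : (S.card : ℝ) ≤ m) (ht : 4 * (t * T ^ 2) ^ 2 * m ≤ 1) (hd : 1 ≤ d) (θ : ℝ) :
    P {ω | θ < |inner ℝ (g i ω) (∑ j ∈ S, g j ω)|} ≤
      2 * ENNReal.ofReal (Real.exp (8 * (t * T ^ 2) ^ 2 * m * d - t * θ)) := by
  have hm := hmeas i
  have hbd : ∀ s : ℝ, s ^ 2 = t ^ 2 → P {ω | t * θ < s * inner ℝ (g i ω) (∑ j ∈ S, g j ω)} ≤
      ENNReal.ofReal (Real.exp (8 * (t * T ^ 2) ^ 2 * m * d - t * θ)) := by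
    intro s hs
    have hst : (s * T ^ 2) ^ 2 = (t * T ^ 2) ^ 2 := by rw [mul_pow, mul_pow, hs]
    rw [← hst]
    exact measure_gt_le_exp (by fun_prop)
      (lintegral_exp_inner_noise_le hmeas hind hsub hT h0 hi hS (by rwa [hst]) hd)
  rw [two_mul]
  refine (measure_mono ?_).trans ((measure_union_le _ _).trans
    (add_le_add (hbd t rfl) (hbd (-t) (by ring))))
  intro ω hω
  rcases lt_abs.1 (show θ < |_| from hω) with h | h
  · exact Or.inl (mul_lt_mul_of_pos_left h ht0)
  · refine Or.inr ?_
    have := mul_lt_mul_of_pos_left h ht0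
    simpa using this

end Probability

/-! ### The three high-probability events. -/

section Events

variable {Ω : Type*} [MeasurableSpace Ω] {P : Measure Ω} [IsProbabilityMeasure P] {n k d : ℕ}
  {g : Fin n → Ω → EuclideanSpace ℝ (Fin d)} {T : ℝ}

/-- Markov's inequality for the uniform majorant at level `exp (3(n+d))`, against a mean of at most
`exp (n+d)`. The constant 12 is this 3 times the 4 from the scale `2 * T`. -/
lemma exists_event_operator_norm (hmeas : ∀ i, Measurable (g i)) (hind : iIndepFun g P)
    (hsub : ∀ i, SubGaussianVec P (g i) T) (hT : 0 < T) :
    ∃ E : Set Ω, MeasurableSet E ∧ P Eᶜ ≤ ENNReal.ofReal (Real.exp (-(2 * n))) ∧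
      ∀ ω ∈ E, ∀ u, ∑ i, inner ℝ (g i ω) u ^ 2 ≤ 12 * T ^ 2 * (n + d) * ‖u‖ ^ 2 := by
  obtain ⟨W, hWm, hWint, hW⟩ := exists_uniform_exp_bound hmeas hind hsub Finset.univ
  rw [Finset.card_univ, Fintype.card_fin] at hWint
  have hR : ENNReal.ofReal (Real.exp (3 * (n + d))) ≠ 0 := by simp [Real.exp_pos]
  refine ⟨{ω | W ω ≤ ENNReal.ofReal (Real.exp (3 * (n + d)))}, measurableSet_le hWm measurable_const,
    ?_, ?_⟩
  · have h1 : P {ω | W ω ≤ ENNReal.ofReal (Real.exp (3 * (n + d)))}ᶜ ≤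
        P {ω | ENNReal.ofReal (Real.exp (3 * (n + d))) ≤ W ω} :=
      measure_mono fun ω hω => (not_le.1 (show ¬W ω ≤ _ from hω)).le
    refine h1.trans ((meas_ge_le_lintegral_div hWm.aemeasurable hR ENNReal.ofReal_ne_top).trans ?_)
    have h2 : (2 : ℝ≥0∞) ^ (n + d) ≤ ENNReal.ofReal (Real.exp (n + d)) := by
      have := two_rpow_le_exp (p := ((n + d : ℕ) : ℝ)) (by positivity)
      rwa [ENNReal.rpow_natCast, Nat.cast_add] at this
    refine (ENNReal.div_le_div_right (hWint.trans h2) _).trans ?_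
    rw [← ENNReal.ofReal_div_of_pos (Real.exp_pos _), ← Real.exp_sub]
    refine ENNReal.ofReal_le_ofReal (Real.exp_le_exp.2 ?_)
    have : (0 : ℝ) ≤ d := by positivity
    linarith
  · intro ω hω u
    rcases eq_or_ne u 0 with rfl | hu
    · simp
    have hn : 0 < ‖u‖ := norm_pos_iff.2 hu
    have h1 := (hW ω (‖u‖⁻¹ • u) (by
      rw [norm_smul, norm_inv, norm_norm]; exact inv_mul_le_one)).trans hω
    have h2 := Real.exp_le_exp.1 ((ENNReal.ofReal_le_ofReal_iff (Real.exp_pos _).le).1 h1)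
    have h3 : ∑ i, (inner ℝ (g i ω) (‖u‖⁻¹ • u) / (2 * T)) ^ 2 =
        (∑ i, inner ℝ (g i ω) u ^ 2) / (4 * T ^ 2 * ‖u‖ ^ 2) := by
      rw [Finset.sum_div]
      refine Finset.sum_congr rfl fun i _ => ?_
      rw [real_inner_smul_right]
      field_simp
      ring
    rw [h3, div_le_iff₀ (by positivity)] at h2
    linarith

lemma exists_event_cross_terms (hmeas : ∀ i, Measurable (g i)) (hind : iIndepFun g P)
    (hsub : ∀ i, SubGaussianVec P (g i) T) (hT : 0 < T) (h0 : ∀ i, ∫ ω, g i ω ∂P = 0)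
    {σ : Fin n → Fin k} {m : ℝ}
    (hσ : ∀ a, ((Finset.univ.filter fun i => σ i = a).card : ℝ) = m) {t : ℝ} (ht0 : 0 < t)
    (ht : 4 * (t * T ^ 2) ^ 2 * m ≤ 1) (hd : 1 ≤ d) (θ : ℝ) :
    ∃ E : Set Ω, MeasurableSet E ∧
      P Eᶜ ≤ n * k * (2 * ENNReal.ofReal (Real.exp (8 * (t * T ^ 2) ^ 2 * m * d - t * θ))) ∧
      ∀ ω ∈ E, ∀ i a, |inner ℝ (g i ω) (∑ j with σ j = a ∧ j ≠ i, g j ω)| ≤ θ := by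
  set B : Fin n × Fin k → Set Ω := fun p =>
    {ω | θ < |inner ℝ (g p.1 ω) (∑ j with σ j = p.2 ∧ j ≠ p.1, g j ω)|} with hB
  have hBm : ∀ p, MeasurableSet (B p) := fun p =>
    measurableSet_lt measurable_const (by fun_prop)
  refine ⟨(⋃ p, B p)ᶜ, (MeasurableSet.iUnion hBm).compl, ?_, ?_⟩
  · rw [compl_compl]
    refine (measure_iUnion_fintype_le P B).trans ?_
    refine (Finset.sum_le_sum fun p _ => measure_abs_inner_noise_gt_le hmeas hind hsub hT h0
      (by simp) ht0 ?_ ht hd θ).trans_eq ?_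
    · rw [← hσ p.2]
      refine Nat.cast_le.2 (Finset.card_le_card fun j hj => ?_)
      simp only [Finset.mem_filter] at hj ⊢
      exact ⟨hj.1, hj.2.1⟩
    · rw [Finset.sum_const, Finset.card_univ, Fintype.card_prod, Fintype.card_fin, Fintype.card_fin,
        nsmul_eq_mul, Nat.cast_mul]
  · intro ω hω i a
    by_contra h
    exact hω (Set.mem_iUnion.2 ⟨(i, a), not_le.1 h⟩)

/-- Halving the exponent leaves second moments finite, so Chebyshev's inequality applies to the
independent sums over `b`. The mean is at most `2nk` and the variance at most `2nk²`; a deviation of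
`3nk` has probability at most `2/(9n)`. -/
lemma exists_event_sum_exp (hn : 1 ≤ n) (hk : 1 ≤ k) (hmeas : ∀ i, Measurable (g i))
    (hind : iIndepFun g P)
    (hsub : ∀ i, SubGaussianVec P (g i) T) {e : Fin n → Fin k → EuclideanSpace ℝ (Fin d)}
    (he : ∀ i b, ‖e i b‖ ≤ 1) :
    ∃ E : Set Ω, MeasurableSet E ∧ P Eᶜ ≤ ENNReal.ofReal (1 / (4 * n)) ∧
      ∀ ω ∈ E, ∑ i, ∑ b, Real.exp ((inner ℝ (g i ω) (e i b) / T) ^ 2 / 2) ≤ 5 * n * k := by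
  set X : Fin n → Ω → ℝ := fun i ω => ∑ b, Real.exp ((inner ℝ (g i ω) (e i b) / T) ^ 2 / 2) with hX
  have hXm : ∀ i, Measurable (X i) := fun i => by
    have := hmeas i
    simp only [hX]
    fun_prop
  have hexp : ∀ i b, Integrable (fun ω => Real.exp ((inner ℝ (g i ω) (e i b) / T) ^ 2)) P := by
    intro i b
    have := hmeas i
    exact integrable_exp_of_lintegral_ne_top (by fun_prop)
      (ne_top_of_le_ne_top (by simp) (hsub i (e i b) (he i b)))
  have hexp2 : ∀ i b, ∫ ω, Real.exp ((inner ℝ (g i ω) (e i b) / T) ^ 2) ∂P ≤ 2 := by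
    intro i b
    have h := hsub i (e i b) (he i b)
    rw [← ofReal_integral_eq_lintegral_ofReal (hexp i b)
      (ae_of_all _ fun ω => (Real.exp_pos _).le)] at h
    exact (ENNReal.ofReal_le_ofReal_iff two_pos.le).1 (by simpa using h)
  have hsum : ∀ i, Integrable (fun ω => ∑ b, Real.exp ((inner ℝ (g i ω) (e i b) / T) ^ 2)) P :=
    fun i => integrable_finsetSum _ fun b _ => hexp i b
  have hsum2 : ∀ i, ∫ ω, ∑ b, Real.exp ((inner ℝ (g i ω) (e i b) / T) ^ 2) ∂P ≤ 2 * k := by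
    intro i
    rw [integral_finsetSum _ fun b _ => hexp i b]
    refine (Finset.sum_le_sum fun b _ => hexp2 i b).trans_eq ?_
    simp [mul_comm]
  have hXnonneg : ∀ i ω, 0 ≤ X i ω := fun i ω => Finset.sum_nonneg fun b _ => (Real.exp_pos _).le
  have hXle : ∀ i ω, X i ω ≤ ∑ b, Real.exp ((inner ℝ (g i ω) (e i b) / T) ^ 2) := fun i ω =>
    Finset.sum_le_sum fun b _ => Real.exp_le_exp.2 (half_le_self (sq_nonneg _))
  have hXsq : ∀ i ω, X i ω ^ 2 ≤ k * ∑ b, Real.exp ((inner ℝ (g i ω) (e i b) / T) ^ 2) := by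
    intro i ω
    refine sq_sum_le_card_mul_sum_sq.trans_eq ?_
    rw [Finset.card_univ, Fintype.card_fin]
    congr 1
    refine Finset.sum_congr rfl fun b _ => ?_
    rw [← Real.exp_nat_mul]
    congr 1
    push_cast
    ring
  have hXsqint : ∀ i, Integrable (fun ω => X i ω ^ 2) P := fun i =>
    ((hsum i).const_mul (k : ℝ)).mono' ((hXm i).pow_const 2).aestronglyMeasurable
      (ae_of_all _ fun ω => by
        rw [Real.norm_eq_abs, abs_of_nonneg (sq_nonneg _)]; exact hXsq i ω)
  have hXL2 : ∀ i, MemLp (X i) 2 P := fun i =>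
    (memLp_two_iff_integrable_sq (hXm i).aestronglyMeasurable).2 (hXsqint i)
  have hXint : ∀ i, Integrable (X i) P := fun i => (hXL2 i).integrable one_le_two
  have hvar : ∀ i, variance (X i) P ≤ 2 * k ^ 2 := by
    intro i
    refine (variance_le_expectation_sq (hXm i).aestronglyMeasurable).trans ?_
    refine (integral_mono (hXsqint i) ((hsum i).const_mul (k : ℝ)) (hXsq i)).trans ?_
    rw [integral_const_mul]
    nlinarith [mul_le_mul_of_nonneg_left (hsum2 i) (Nat.cast_nonneg (α := ℝ) k)]
  have hindX : iIndepFun X P :=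
    hind.comp (fun i x => ∑ b, Real.exp ((inner ℝ x (e i b) / T) ^ 2 / 2)) fun i => by fun_prop
  have hVar : variance (∑ i, X i) P ≤ 2 * n * k ^ 2 := by
    rw [IndepFun.variance_sum (fun i _ => hXL2 i) fun i _ j _ hij => hindX.indepFun hij]
    refine (Finset.sum_le_sum fun i _ => hvar i).trans_eq ?_
    simp
    ring
  have hmean : ∫ ω, (∑ i, X i) ω ∂P ≤ 2 * n * k := by
    simp only [Finset.sum_apply]
    rw [integral_finsetSum _ fun i _ => hXint i]
    refine (Finset.sum_le_sum fun i _ =>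
      (integral_mono (hXint i) (hsum i) (hXle i)).trans (hsum2 i)).trans_eq ?_
    simp
    ring
  have hn' : (1 : ℝ) ≤ n := by exact_mod_cast hn
  have hk' : (1 : ℝ) ≤ k := by exact_mod_cast hk
  have hSm : Measurable fun ω => ∑ i, X i ω := by fun_prop
  have hcheb := meas_ge_le_variance_div_sq (μ := P) (memLp_finsetSum' Finset.univ fun i _ => hXL2 i)
    (show (0 : ℝ) < 3 * n * k by positivity)
  refine ⟨{ω | ∑ i, X i ω ≤ 5 * n * k}, measurableSet_le hSm measurable_const, ?_, fun ω hω => hω⟩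
  refine le_trans (measure_mono ?_) (hcheb.trans (ENNReal.ofReal_le_ofReal ?_))
  · intro ω hω
    have h1 : 5 * n * k < ∑ i, X i ω := not_le.1 hω
    refine le_trans (b := (∑ i, X i) ω - ∫ ω, (∑ i, X i) ω ∂P) ?_ (le_abs_self _)
    rw [Finset.sum_apply]
    linarith
  · refine (div_le_div_of_nonneg_right hVar (by positivity)).trans ?_
    rw [div_le_div_iff₀ (by positivity) (by positivity)]
    have : (0 : ℝ) ≤ n ^ 2 * k ^ 2 := by positivity
    nlinarith

end Events

/-! ### Choice of parameters and scalar inequalities. -/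

/-- A choice of the exponential-moment parameter that makes the cross-term bound summable. -/
lemma exists_chernoff_parameter {m d β L : ℝ} (hm : 0 < m) (hd : 0 < d) (hβ : 0 < β)
    (h1 : 524288 * d * L ≤ β ^ 2 * m) (h2 : 1024 * L ≤ √m * β) :
    ∃ l : ℝ, 0 < l ∧ 4 * l ^ 2 * m ≤ 1 ∧ 8 * l ^ 2 * m * d - l * (m * β / 64) ≤ -(4 * L) := by
  have hsm : 0 < √m := Real.sqrt_pos.2 hm
  have hsq : √m ^ 2 = m := Real.sq_sqrt hm.le
  -- The first cap on `l` makes the quadratic term at most half of the linear one; the second is the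
  -- Jensen constraint. The witness is the smaller cap.
  have hkey : ∀ l : ℝ, 0 < l → l ≤ β / (1024 * d) → l ≤ 1 / (2 * √m) → 512 * L ≤ l * m * β →
      0 < l ∧ 4 * l ^ 2 * m ≤ 1 ∧ 8 * l ^ 2 * m * d - l * (m * β / 64) ≤ -(4 * L) := by
    intro l hl0 hl1 hl2 hl3
    rw [le_div_iff₀ (by positivity)] at hl1 hl2
    refine ⟨hl0, ?_, ?_⟩
    · have : 0 ≤ l * (2 * √m) := by positivity
      calc 4 * l ^ 2 * m = (l * (2 * √m)) ^ 2 := by rw [mul_pow, mul_pow, hsq]; ring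
        _ ≤ 1 := by nlinarith
    · have h3 := mul_le_mul_of_nonneg_left hl1 (show 0 ≤ l * m by positivity)
      nlinarith
  rcases le_total (β / (1024 * d)) (1 / (2 * √m)) with h | h
  · refine ⟨β / (1024 * d), hkey _ (by positivity) le_rfl h ?_⟩
    rw [div_mul_eq_mul_div, div_mul_eq_mul_div, le_div_iff₀ (by positivity)]
    linarith
  · refine ⟨1 / (2 * √m), hkey _ (by positivity) h le_rfl ?_⟩
    have : 1 / (2 * √m) * m * β = √m * β / 2 := by
      field_simp
      rw [hsq]
    rw [this]
    linarith

/-- A large linear term forces a large Gaussian-type weight. -/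
lemma linear_term_le {D T s x : ℝ} (hT : 0 < T) (hD : 0 < D) (hs : 0 ≤ s) (hsD : s * T ≤ 2 * D) :
    4 * (D * (T * x)) ≤
      D ^ 2 / 4 + 256 * T ^ 2 * Real.exp (-(s ^ 2 / 4096)) * Real.exp (x ^ 2 / 2) := by
  rcases le_or_gt x (D / T / 16) with hx | hx
  · have h1 : T * x ≤ D / 16 := by
      calc T * x ≤ T * (D / T / 16) := by gcongr
        _ = D / 16 := by field_simp
    have h2 := mul_le_mul_of_nonneg_left h1 hD.le
    have h3 : 0 ≤ 256 * T ^ 2 * Real.exp (-(s ^ 2 / 4096)) * Real.exp (x ^ 2 / 2) := by positivity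
    nlinarith
  -- Now `x` dominates both `D / (16T)` and `s / 32`. Thus the linear term is at most `64T²x²`,
  -- while `s²/4096 ≤ x²/4` leaves `exp (x²/4)` to absorb `x²/4`.
  · have hDx : D ≤ 16 * T * x := by
      have := mul_lt_mul_of_pos_left hx hT
      have h2 : T * (D / T / 16) = D / 16 := by field_simp
      linarith
    have hx0 : 0 < x := lt_trans (by positivity) hx
    have hsx : s ≤ 32 * x := by
      refine le_of_mul_le_mul_right ?_ hT
      linarith
    have h1 : x ^ 2 / 4 ≤ Real.exp (-(s ^ 2 / 4096) + x ^ 2 / 2) := by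
      have h2 : x ^ 2 / 4 + 1 ≤ Real.exp (-(s ^ 2 / 4096) + x ^ 2 / 2) :=
        (Real.add_one_le_exp _).trans (Real.exp_le_exp.2 (by nlinarith))
      linarith
    rw [mul_assoc, ← Real.exp_add]
    have h3 := mul_le_mul_of_nonneg_left h1 (show 0 ≤ 256 * T ^ 2 by positivity)
    have h4 : D * (T * x) ≤ 16 * T * x * (T * x) := by gcongr
    nlinarith [sq_nonneg D]

lemma minSep_le {k d : ℕ} (μ : Fin k → EuclideanSpace ℝ (Fin d)) {a b : Fin k} (hab : a ≠ b) :
    minSep μ ≤ ‖μ b - μ a‖ := by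
  rw [norm_sub_rev]
  exact ciInf_le (f := fun p : {p : Fin k × Fin k // p.1 ≠ p.2} => ‖μ p.1.1 - μ p.1.2‖)
    (Set.finite_range _).bddBelow ⟨(a, b), hab⟩

lemma minSep_nonneg {k d : ℕ} (μ : Fin k → EuclideanSpace ℝ (Fin d)) : 0 ≤ minSep μ :=
  Real.iInf_nonneg fun _ => norm_nonneg _

lemma log_le_two_mul_sqrt {x : ℝ} (hx : 0 < x) : Real.log x ≤ 2 * √x := by
  have h := Real.log_le_sub_one_of_pos (Real.sqrt_pos.2 hx)
  rw [Real.log_sqrt hx.le] at h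
  linarith

/-! ### The good event and the exponential error bound. -/

section Main

variable {Ω : Type*} [MeasurableSpace Ω] {P : Measure Ω} [IsProbabilityMeasure P] {n k d : ℕ}
  {μ : Fin k → EuclideanSpace ℝ (Fin d)} {σ : Fin n → Fin k}
  {g : Fin n → Ω → EuclideanSpace ℝ (Fin d)} {τ : ℝ}

/-- The good event: the noise matrix has bounded operator norm, the cross terms are small and the
linear terms have bounded exponential averages. -/
lemma exists_good_event (hn : 4 ≤ n) (hk : 2 ≤ k) (hmod : IsModel P σ g τ)
    {e : Fin n → Fin k → EuclideanSpace ℝ (Fin d)} (he : ∀ i b, ‖e i b‖ ≤ 1) {s : ℝ}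
    (hs : 100000 * (√((k : ℝ) * d / n * Real.log n) + (k : ℝ) * d / n + k) ≤ s ^ 2)
    (hd : 1 ≤ d) :
    ∃ E : Set Ω, MeasurableSet E ∧ 1 - 2 / (n : ℝ) ≤ P.real E ∧ ∀ ω ∈ E,
      (∀ u, ∑ i, inner ℝ (g i ω) u ^ 2 ≤ 12 * (2 * τ) ^ 2 * (n + d) * ‖u‖ ^ 2) ∧
      (∀ i a, |inner ℝ (g i ω) (∑ j with σ j = a ∧ j ≠ i, g j ω)| ≤
        (n : ℝ) / k * ((s * τ) ^ 2 / 64)) ∧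
      ∑ i, ∑ b, Real.exp ((inner ℝ (g i ω) (e i b) / (2 * τ)) ^ 2 / 2) ≤ 5 * n * k := by
  have hτ := hmod.tau_pos
  have hT : 0 < 2 * τ := by linarith
  have hn4 : (4 : ℝ) ≤ n := by exact_mod_cast hn
  have hn' : (0 : ℝ) < n := by linarith
  have hk2 : (2 : ℝ) ≤ k := by exact_mod_cast hk
  have hk' : (0 : ℝ) < k := by linarith
  have hd1 : (1 : ℝ) ≤ d := by exact_mod_cast hd
  have hd' : (0 : ℝ) < d := by linarith
  have hL : 0 ≤ Real.log n := Real.log_nonneg (by linarith)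
  have hsub : ∀ i, SubGaussianVec P (g i) (2 * τ) := fun i =>
    subGaussianVec_of_psi2NormVec_le hτ.le (by linarith) (hmod.subgaussian i)
  have hm : 0 < (n : ℝ) / k := by positivity
  have hratio : (0 : ℝ) ≤ (k : ℝ) * d / n := by positivity
  have hsk : 100000 * (k : ℝ) ≤ s ^ 2 := by
    linarith [Real.sqrt_nonneg ((k : ℝ) * d / n * Real.log n)]
  -- Balanced clusters have positive integer size. This is used for the union bound over `n * k`
  -- pairs.
  have hkn : (k : ℝ) ≤ n := by
    have hσ0 := hmod.balanced ⟨0, by omega⟩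
    by_contra! hlt
    have h1 : (n : ℝ) / k < 1 := (div_lt_one hk').2 hlt
    rw [← hσ0] at h1 hm
    have h2 : 0 < (Finset.univ.filter (fun i : Fin n => σ i = ⟨0, by omega⟩)).card := by
      exact_mod_cast hm
    have h3 : (Finset.univ.filter (fun i : Fin n => σ i = ⟨0, by omega⟩)).card < 1 := by
      exact_mod_cast h1
    omega
  -- With `T = 2τ` the threshold `m(sτ)²/64` equals `m * β * T² / 64` for `β = s²/4`. The
  -- square-root and `k` terms of the hypothesis give the two required inequalities.
  obtain ⟨l, hl0, hl1, hl2⟩ := exists_chernoff_parameter (m := (n : ℝ) / k) (d := d)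
    (β := s ^ 2 / 4) (L := Real.log n) hm hd' (by linarith)
    (by
      have h1 : 100000 * √((k : ℝ) * d / n * Real.log n) ≤ s ^ 2 := by linarith
      have h2 : (100000 * √((k : ℝ) * d / n * Real.log n)) ^ 2 ≤ (s ^ 2) ^ 2 :=
        pow_le_pow_left₀ (by positivity) h1 2
      rw [mul_pow, Real.sq_sqrt (by positivity)] at h2
      have h3 := mul_le_mul_of_nonneg_right h2 hm.le
      have h4 : 100000 ^ 2 * ((k : ℝ) * d / n * Real.log n) * ((n : ℝ) / k) =
          100000 ^ 2 * (d * Real.log n) := by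
        field_simp
      rw [h4] at h3
      have h5 : 0 ≤ d * Real.log n := by positivity
      nlinarith)
    (by
      have h1 : √(n : ℝ) ≤ √((n : ℝ) / k) * k := by
        rw [Real.sqrt_le_left (by positivity), mul_pow, Real.sq_sqrt hm.le]
        have : (n : ℝ) / k * (k : ℝ) ^ 2 = n * k := by field_simp
        rw [this]
        nlinarith
      have h2 := log_le_two_mul_sqrt hn'
      have h3 := mul_le_mul_of_nonneg_left hsk (Real.sqrt_nonneg ((n : ℝ) / k))
      nlinarith)
  obtain ⟨E₁, hE₁, hP₁, h₁⟩ := exists_event_operator_norm hmod.measurable hmod.indep hsub hT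
  obtain ⟨E₂, hE₂, hP₂, h₂⟩ := exists_event_cross_terms hmod.measurable hmod.indep hsub hT
    hmod.centered hmod.balanced (t := l / (2 * τ) ^ 2) (by positivity)
    (by rwa [div_mul_cancel₀ _ (by positivity)]) hd ((n : ℝ) / k * ((s * τ) ^ 2 / 64))
  obtain ⟨E₃, hE₃, hP₃, h₃⟩ := exists_event_sum_exp (by omega) (by omega) hmod.measurable
    hmod.indep hsub he
  refine ⟨E₁ ∩ E₂ ∩ E₃, (hE₁.inter hE₂).inter hE₃, ?_, fun ω hω =>
    ⟨h₁ ω hω.1.1, h₂ ω hω.1.2, h₃ ω hω.2⟩⟩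
  have hQ₁ : P.real E₁ᶜ ≤ 1 / (2 * n) := by
    have h1 : P.real E₁ᶜ ≤ Real.exp (-(2 * n)) :=
      ENNReal.toReal_le_of_le_ofReal (Real.exp_pos _).le hP₁
    refine h1.trans ?_
    rw [Real.exp_neg, ← one_div]
    exact one_div_le_one_div_of_le (by positivity) (by linarith [Real.add_one_le_exp (2 * (n : ℝ))])
  have hQ₂ : P.real E₂ᶜ ≤ 1 / (2 * n) := by
    have hexp : 8 * (l / (2 * τ) ^ 2 * (2 * τ) ^ 2) ^ 2 * ((n : ℝ) / k) * d
        - l / (2 * τ) ^ 2 * ((n : ℝ) / k * ((s * τ) ^ 2 / 64)) ≤ -(4 * Real.log n) := by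
      refine le_trans (le_of_eq ?_) hl2
      rw [div_mul_cancel₀ _ (by positivity)]
      field_simp
      ring
    have h1 : P E₂ᶜ ≤ ENNReal.ofReal (n * k * (2 * Real.exp (-(4 * Real.log n)))) := by
      refine hP₂.trans ?_
      rw [ENNReal.ofReal_mul (by positivity), ENNReal.ofReal_mul (by positivity),
        ENNReal.ofReal_mul (by positivity), ENNReal.ofReal_natCast, ENNReal.ofReal_natCast,
        ENNReal.ofReal_ofNat]
      gcongr
    refine (ENNReal.toReal_le_of_le_ofReal (by positivity) h1).trans ?_
    have h2 : Real.exp (-(4 * Real.log n)) = 1 / (n : ℝ) ^ 4 := by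
      rw [Real.exp_neg, ← one_div, show 4 * Real.log n = Real.log ((n : ℝ) ^ 4) by
        rw [Real.log_pow]; norm_num, Real.exp_log (by positivity)]
    rw [h2]
    calc (n : ℝ) * k * (2 * (1 / (n : ℝ) ^ 4)) ≤ n * n * (2 * (1 / (n : ℝ) ^ 4)) := by gcongr
      _ = 2 / (n : ℝ) ^ 2 := by field_simp
      _ ≤ 1 / (2 * n) := by
        rw [div_le_div_iff₀ (by positivity) (by positivity)]
        nlinarith
  have hQ₃ : P.real E₃ᶜ ≤ 1 / (4 * n) :=
    ENNReal.toReal_le_of_le_ofReal (by positivity) hP₃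
  have hcompl : P.real (E₁ ∩ E₂ ∩ E₃)ᶜ ≤ 1 / (2 * n) + 1 / (2 * n) + 1 / (4 * n) := by
    rw [Set.compl_inter, Set.compl_inter]
    exact (measureReal_union_le _ _).trans
      (add_le_add ((measureReal_union_le _ _).trans (add_le_add hQ₁ hQ₂)) hQ₃)
  rw [measureReal_compl ((hE₁.inter hE₂).inter hE₃), probReal_univ] at hcompl
  have hfinal : (1 : ℝ) / (2 * n) + 1 / (2 * n) + 1 / (4 * n) ≤ 2 / n := by
    have h1 : (1 : ℝ) / (2 * n) = 1 / 2 * (1 / n) := by field_simp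
    have h2 : (1 : ℝ) / (4 * n) = 1 / 4 * (1 / n) := by field_simp
    have h3 : (2 : ℝ) / n = 2 * (1 / n) := by field_simp
    have h4 : 0 < 1 / (n : ℝ) := by positivity
    rw [h1, h2, h3]
    linarith
  linarith

/-- The SDP error decays exponentially in the squared signal-to-noise ratio. -/
theorem exists_event_sdp_error_le (hn : 4 ≤ n) (hk : 2 ≤ k) (hmod : IsModel P σ g τ)
    (hs : 100000 * (√((k : ℝ) * d / n * Real.log n) + (k : ℝ) * d / n + k) ≤ snr μ τ ^ 2) :
    ∃ E : Set Ω, MeasurableSet E ∧ 1 - 2 / (n : ℝ) ≤ P.real E ∧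
      ∀ ω ∈ E, (∃ Y, IsSDPSolution k (point μ σ g ω) Y) ∧
        ∀ Y, IsSDPSolution k (point μ σ g ω) Y →
          l1Norm (Y - trueClusterMatrix σ) / l1Norm (trueClusterMatrix σ)
            ≤ 40960 * Real.exp (-(snr μ τ ^ 2 / 4096)) := by
  set s := snr μ τ with hsdef
  have hτ := hmod.tau_pos
  have hn4 : (4 : ℝ) ≤ n := by exact_mod_cast hn
  have hn' : (0 : ℝ) < n := by linarith
  have hk2 : (2 : ℝ) ≤ k := by exact_mod_cast hk
  have hk' : (0 : ℝ) < k := by linarith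
  have hratio : (0 : ℝ) ≤ (k : ℝ) * d / n := by positivity
  have hsqrt := Real.sqrt_nonneg ((k : ℝ) * d / n * Real.log n)
  have hsk : 100000 * (k : ℝ) ≤ s ^ 2 := by linarith
  have hs0 : 0 ≤ s := div_nonneg (minSep_nonneg μ) hτ.le
  have hspos : 0 < s := by
    rcases hs0.eq_or_lt with h | h
    · rw [← h] at hsk; nlinarith
    · exact h
  have hsτ : s * τ = minSep μ := div_mul_cancel₀ _ hτ.ne'
  have hΔ : 0 < s * τ := by positivity
  have hsep : ∀ a b, a ≠ b → s * τ ≤ ‖μ b - μ a‖ := fun a b hab => hsτ ▸ minSep_le μ hab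
  -- In dimension zero two centers would coincide, contradicting positive separation.
  have hd : 1 ≤ d := by
    by_contra! h
    obtain rfl : d = 0 := by omega
    have h1 := hsep ⟨0, by omega⟩ ⟨1, by omega⟩ (by simp)
    rw [Subsingleton.elim (μ _ - μ _) 0, norm_zero] at h1
    linarith
  -- For `b = σ i` the inverse of zero is zero and so is this vector; hence only `‖e i b‖ ≤ 1` is
  -- claimed.
  set e : Fin n → Fin k → EuclideanSpace ℝ (Fin d) := fun i b =>
    ‖μ b - μ (σ i)‖⁻¹ • (μ b - μ (σ i)) with he
  have he1 : ∀ i b, ‖e i b‖ ≤ 1 := fun i b => by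
    rw [he, norm_smul, norm_inv, norm_norm]; exact inv_mul_le_one
  have hm : 0 < (n : ℝ) / k := by positivity
  obtain ⟨E, hE, hPE, hgood⟩ := exists_good_event hn hk hmod he1 hs hd
  refine ⟨E, hE, hPE, fun ω hω => ?_⟩
  obtain ⟨hop, hcross, hlin⟩ := hgood ω hω
  refine ⟨exists_isSDPSolution _ ⟨_, trueClusterMatrix_isFeasible hmod.balanced⟩, fun Y hY => ?_⟩
  set bad : Fin n → Fin k → ℝ := fun i b => 256 * (2 * τ) ^ 2 * Real.exp (-(s ^ 2 / 4096)) *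
    Real.exp ((inner ℝ (g i ω) (e i b) / (2 * τ)) ^ 2 / 2) with hbad
  have hmain := crossMass_le (m := (n : ℝ) / k) (μ := μ) (g := fun i => g i ω) (bad := bad)
    (K := 12 * (2 * τ) ^ 2 * (n + d)) hm rfl hmod.balanced hY.1 hΔ hsep (by positivity) hop
    (by
      have h1 : 12 * (2 * τ) ^ 2 * (n + d) / ((n : ℝ) / k) =
          48 * τ ^ 2 * (k + (k : ℝ) * d / n) := by
        field_simp
        ring
      rw [h1]
      have h2 : 49152 * (k + (k : ℝ) * d / n) ≤ s ^ 2 := by linarith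
      have h3 := mul_le_mul_of_nonneg_left h2 (sq_nonneg τ)
      nlinarith)
    hcross (fun i b => by positivity)
    (fun i b hib => by
      have hD : 0 < ‖μ b - μ (σ i)‖ := hΔ.trans_le (hsep _ _ hib)
      have h1 := linear_term_le (T := 2 * τ) (s := s) (x := inner ℝ (g i ω) (e i b) / (2 * τ))
        (by positivity) hD hs0 (by linarith [hsep _ _ hib])
      refine le_trans (le_of_eq ?_) h1
      rw [mul_div_cancel₀ _ (by positivity), he, real_inner_smul_right, mul_inv_cancel_left₀ hD.ne'])
    (by
      have h1 := hY.2 _ (trueClusterMatrix_isFeasible hmod.balanced)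
      rwa [trace_transpose_mul_sqDistMatrix, trace_transpose_mul_sqDistMatrix] at h1)
  rw [hY.1.l1Norm_sub hmod.balanced, l1Norm_trueClusterMatrix hmod.balanced,
    div_le_iff₀ (by positivity)]
  have hsum : ∑ i, ∑ b, bad i b ≤
      256 * (2 * τ) ^ 2 * Real.exp (-(s ^ 2 / 4096)) * (5 * n * k) := by
    simp only [hbad, ← Finset.mul_sum]
    exact mul_le_mul_of_nonneg_left hlin (by positivity)
  have h1 := hmain.trans (mul_le_mul_of_nonneg_left hsum hm.le)
  have h2 : (n : ℝ) / k * (256 * (2 * τ) ^ 2 * Real.exp (-(s ^ 2 / 4096)) * (5 * n * k)) ≤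
      (s * τ) ^ 2 / 4 * (20480 * Real.exp (-(s ^ 2 / 4096)) * (n * ((n : ℝ) / k))) := by
    have h3 : 0 ≤ 5120 * τ ^ 2 * (Real.exp (-(s ^ 2 / 4096)) * (n * ((n : ℝ) / k))) := by positivity
    -- Summing over target clusters costs a factor `k`, paid for by dividing by the squared
    -- separation.
    have h4 := mul_le_mul_of_nonneg_left (show (k : ℝ) ≤ s ^ 2 by linarith) h3
    nlinarith
  have h5 := le_of_mul_le_mul_left (h1.trans h2) (by positivity)
  linarith

end Main

/-! ### Exact recovery. -/

lemma exact_recovery_condition {A n k d s2 : ℝ} (hA : 0 < A) (hn : 4 ≤ n) (hk : 2 ≤ k)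
    (hd : d ≤ A * n)
    (hs : 100000 * (2 * A + 1) * (k + Real.log n) ≤ s2) :
    100000 * (√(k * d / n * Real.log n) + k * d / n + k) ≤ s2 := by
  have hL : 0 ≤ Real.log n := Real.log_nonneg (by linarith)
  have h1 : k * d / n ≤ A * k := by
    rw [div_le_iff₀ (by linarith)]
    nlinarith
  have h2 : √(k * d / n * Real.log n) ≤ A * k + Real.log n := by
    have hAk : 0 ≤ A * k := by positivity
    rw [Real.sqrt_le_left (by linarith)]
    have := mul_le_mul_of_nonneg_right h1 hL
    nlinarith [mul_nonneg hAk hL]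
  nlinarith [mul_nonneg hA.le hL]

lemma exact_recovery_error {n k s2 : ℝ} (hn : 4 ≤ n) (hk : 2 ≤ k)
    (hs : 100000 * (k + Real.log n) ≤ s2) :
    40960 * Real.exp (-(s2 / 4096)) * (n * (n / k)) < 1 / 4 := by
  have hn0 : 0 < n := by linarith
  have hk0 : 0 < k := by linarith
  have hL : 0 ≤ Real.log n := Real.log_nonneg (by linarith)
  -- Since `100000/4096 > 24` and `k ≥ 2`, the exponent exceeds `40 + 2 log n`: the logarithm
  -- cancels the mass `n²`, and 40 beats the numerical prefactor.
  have h1 : Real.exp (-(s2 / 4096)) ≤ Real.exp (-40) * Real.exp (-(2 * Real.log n)) := by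
    rw [← Real.exp_add]
    exact Real.exp_le_exp.2 (by linarith)
  have h2 : Real.exp (-(2 * Real.log n)) = 1 / n ^ 2 := by
    rw [Real.exp_neg, ← one_div, show 2 * Real.log n = Real.log (n ^ 2) by
      rw [Real.log_pow]; norm_num, Real.exp_log (by positivity)]
  have h3 : Real.exp (-40) < 1 / 163840 := by
    have h4 : (2 : ℝ) ^ 40 ≤ Real.exp 1 ^ 40 :=
      pow_le_pow_left₀ two_pos.le (by linarith [Real.add_one_le_exp (1 : ℝ)]) _
    rw [← Real.exp_nat_mul] at h4
    norm_num at h4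
    rw [Real.exp_neg, ← one_div]
    exact one_div_lt_one_div_of_lt (by norm_num) (by linarith)
  have h5 : n * (n / k) ≤ n ^ 2 := by
    rw [sq]
    exact mul_le_mul_of_nonneg_left (div_le_self hn0.le (by linarith)) hn0.le
  calc 40960 * Real.exp (-(s2 / 4096)) * (n * (n / k))
      ≤ 40960 * (Real.exp (-40) * (1 / n ^ 2)) * n ^ 2 := by
        rw [h2] at h1
        gcongr
    _ = 40960 * Real.exp (-40) := by field_simp
    _ < 1 / 4 := by linarith

lemma roundMatrix_eq_trueClusterMatrix {n k : ℕ} {σ : Fin n → Fin k}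
    {Y : Matrix (Fin n) (Fin n) ℝ} (h : l1Norm (Y - trueClusterMatrix σ) < 1 / 4) :
    roundMatrix Y = trueClusterMatrix σ := by
  have hentry : ∀ i j, |Y i j - trueClusterMatrix σ i j| < 1 / 4 := by
    intro i j
    refine lt_of_le_of_lt ?_ h
    refine (Finset.single_le_sum (f := fun j => |(Y - trueClusterMatrix σ) i j|)
      (fun _ _ => abs_nonneg _) (Finset.mem_univ j)).trans ?_
    exact Finset.single_le_sum (f := fun i => ∑ j, |(Y - trueClusterMatrix σ) i j|)
      (fun _ _ => Finset.sum_nonneg fun _ _ => abs_nonneg _) (Finset.mem_univ i)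
  ext i j
  have hround : ∀ z : ℤ, |Y i j - z| < 1 / 4 → round (Y i j) = z := by
    intro z hz
    rw [abs_lt] at hz
    rw [round_eq, Int.floor_eq_iff]
    constructor <;> linarith
  have hij := hentry i j
  simp only [roundMatrix, trueClusterMatrix, Matrix.of_apply] at hij ⊢
  split_ifs at hij ⊢
  · rw [hround 1 (by simpa using hij), Int.cast_one]
  · rw [hround 0 (by simpa using hij), Int.cast_zero]

end SGMM

theorem corollary3 :
    (∃ Cs Cm Ce : ℝ, 0 < Cs ∧ 0 < Cm ∧ 0 < Ce ∧
      ∀ (n k d : ℕ), 4 ≤ n → 2 ≤ k →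
        ∀ (Ω : Type u) [MeasurableSpace Ω] (P : Measure Ω) [IsProbabilityMeasure P]
          (μ : Fin k → EuclideanSpace ℝ (Fin d)) (σ : Fin n → Fin k)
          (g : Fin n → Ω → EuclideanSpace ℝ (Fin d)) (τ : ℝ),
          SGMM.IsModel P σ g τ →
          Cs * (Real.sqrt ((k : ℝ) * d / n * Real.log n) + (k : ℝ) * d / n + k)
            ≤ SGMM.snr μ τ ^ 2 →
          ∃ E : Set Ω, MeasurableSet E ∧ 1 - 2 / (n : ℝ) ≤ P.real E ∧
            ∀ ω ∈ E, (∃ Y, SGMM.IsSDPSolution k (SGMM.point μ σ g ω) Y) ∧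
              ∀ Y, SGMM.IsSDPSolution k (SGMM.point μ σ g ω) Y →
                SGMM.l1Norm (Y - SGMM.trueClusterMatrix σ)
                    / SGMM.l1Norm (SGMM.trueClusterMatrix σ)
                  ≤ Cm * Real.exp (-(SGMM.snr μ τ ^ 2 / Ce))) ∧
    (∀ A : ℝ, 0 < A → ∃ C : ℝ, 0 < C ∧
        ∀ (n k d : ℕ), 4 ≤ n → 2 ≤ k → (d : ℝ) ≤ A * n →
        ∀ (Ω : Type u) [MeasurableSpace Ω] (P : Measure Ω) [IsProbabilityMeasure P]
          (μ : Fin k → EuclideanSpace ℝ (Fin d)) (σ : Fin n → Fin k)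
          (g : Fin n → Ω → EuclideanSpace ℝ (Fin d)) (τ : ℝ),
          SGMM.IsModel P σ g τ →
          C * ((k : ℝ) + Real.log n) ≤ SGMM.snr μ τ ^ 2 →
          ∃ E : Set Ω, MeasurableSet E ∧ 1 - 2 / (n : ℝ) ≤ P.real E ∧
            ∀ ω ∈ E, (∃ Y, SGMM.IsSDPSolution k (SGMM.point μ σ g ω) Y) ∧
              ∀ Y, SGMM.IsSDPSolution k (SGMM.point μ σ g ω) Y →
                SGMM.l1Norm (Y - SGMM.trueClusterMatrix σ) < 1 / 4 ∧
                SGMM.roundMatrix Y = SGMM.trueClusterMatrix σ) := by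
  refine ⟨⟨100000, 40960, 4096, by norm_num, by norm_num, by norm_num, ?_⟩, ?_⟩
  · intro n k d hn hk Ω _ P _ μ σ g τ hmod hs
    exact SGMM.exists_event_sdp_error_le hn hk hmod hs
  · intro A hA
    refine ⟨100000 * (2 * A + 1), by positivity, ?_⟩
    intro n k d hn hk hd Ω _ P _ μ σ g τ hmod hs
    have hn4 : (4 : ℝ) ≤ n := by exact_mod_cast hn
    have hk2 : (2 : ℝ) ≤ k := by exact_mod_cast hk
    have hL : 0 ≤ Real.log n := Real.log_nonneg (by linarith)
    obtain ⟨E, hE, hPE, hsol⟩ := SGMM.exists_event_sdp_error_le (μ := μ) hn hk hmod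
      (SGMM.exact_recovery_condition hA hn4 hk2 hd hs)
    refine ⟨E, hE, hPE, fun ω hω => ⟨(hsol ω hω).1, fun Y hY => ?_⟩⟩
    have hpos : (0 : ℝ) < n * ((n : ℝ) / k) := by positivity
    have h1 := (hsol ω hω).2 Y hY
    rw [SGMM.l1Norm_trueClusterMatrix hmod.balanced, div_le_iff₀ hpos] at h1
    have h2 := h1.trans_lt (SGMM.exact_recovery_error hn4 hk2 (by nlinarith))
    exact ⟨h2, SGMM.roundMatrix_eq_trueClusterMatrix h2⟩
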